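/- Fix $\gamma\in(0,2)$. There are constants $c_0,c_1>0$, depending only on $\gamma$, such that the following holds. Let $(L_t,R_t)_{t\in\mathbb R}$ be a two-sided two-dimensional Brownian motion with $L_0=R_0=0$ and $$\operatorname{Var}(L_t)=\operatorname{Var}(R_t)=|t|,\qquad \operatorname{Cov}(L_t,R_t)=-\cos\!\left(\frac{\pi\gamma^2}{4}\right)|t|\qquad(t\in\mathbb R),$$ and let $\theta$ be a random variable independent of $(L,R)$ and uniform on $[0,1]$. For $\epsilon>0$ let $\mathcal G^\epsilon$ be the whole-plane mated-CRT map, i.e. the random multigraph with vertex set $\epsilon\mathbb Z+\epsilon\theta$ in which vertices $x_1<x_2$ are joined by at least one edge if and only if $$\Big(\inf_{t\in[x_1-\epsilon,x_1]}L_t\Big)\vee\Big(\inf_{t\in[x_2-\epsilon,x_2]}L_t\Big)\le\inf_{t\in[x_1,x_2-\epsilon]}L_t$$ or the same condition holds with $R$ in place of $L$; they are joined by exactly two edges if $x_2\ne x_1+\epsilon$ and both conditions hold, and by at most one edge otherwise. Write $\deg(x;\mathcal G^\epsilon)$ for the number of edges with $x$ as an endpoint. Then for every integer $n\ge 1$,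 every $\epsilon>0$ and every vertex $x\in\epsilon\mathbb Z+\epsilon\theta$ chosen as a measurable function of $\theta$ (for instance $x=\epsilon k+\epsilon\theta$ with $k\in\mathbb Z$ fixed), almost surely $$\mathbb P\big[\deg(x;\mathcal G^\epsilon)>n\,\big|\,\theta\big]\le c_0e^{-c_1n}.$$ -/

import Mathlib

open MeasureTheory ProbabilityTheory

namespace MatedCRT

/-- The correlation `-cos(π γ² / 4)` of the two Brownian coordinates. -/
noncomputable def correlation (γ : ℝ) : ℝ := -Real.cos (Real.pi * γ ^ 2 / 4)

/-- `(L t, R t)`, `t ∈ ℝ`, is a two-sided two-dimensional Brownian motion whose coordinates are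
standard two-sided Brownian motions with correlation `ρ`: it vanishes at time `0`, has almost surely
continuous paths, has independent increments on the whole line, and its increment over `[s, t]` is
a centred Gaussian vector with covariance matrix `(t - s) • !![1, ρ; ρ, 1]`. -/
structure IsCorrelatedBM {Ω : Type*} [MeasurableSpace Ω] (ρ : ℝ) (L R : ℝ → Ω → ℝ)
    (μ : Measure Ω) : Prop where
  measurable_left : ∀ t, Measurable (L t)
  measurable_right : ∀ t, Measurable (R t)
  start : ∀ᵐ ω ∂μ, L 0 ω = 0 ∧ R 0 ω = 0
  continuous_paths : ∀ᵐ ω ∂μ, Continuous (fun t => L t ω) ∧ Continuous (fun t => R t ω)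
  indep_increments : HasIndepIncrements (fun t ω => (L t ω, R t ω)) μ
  gaussian_increments : ∀ s t, s ≤ t →
    HasGaussianLaw (fun ω => (L t ω - L s ω, R t ω - R s ω)) μ
  mean_left : ∀ s t, s ≤ t → μ[fun ω => L t ω - L s ω] = 0
  mean_right : ∀ s t, s ≤ t → μ[fun ω => R t ω - R s ω] = 0
  variance_left : ∀ s t, s ≤ t → Var[fun ω => L t ω - L s ω; μ] = t - s
  variance_right : ∀ s t, s ≤ t → Var[fun ω => R t ω - R s ω; μ] = t - s
  covariance_left_right : ∀ s t, s ≤ t →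
    cov[fun ω => L t ω - L s ω, fun ω => R t ω - R s ω; μ] = ρ * (t - s)

/-- The infimum of the path `f` over the time interval `[a, b]`. -/
noncomputable def infOn (f : ℝ → ℝ) (a b : ℝ) : ℝ := sInf (f '' Set.Icc a b)

/-- For `x₁ < x₂`: the cells `[x₁ - ε, x₁]` and `[x₂ - ε, x₂]` can be joined by a horizontal
segment lying below the graph of the path `f`. -/
def CellAdj (f : ℝ → ℝ) (ε x₁ x₂ : ℝ) : Prop :=
  max (infOn f (x₁ - ε) x₁) (infOn f (x₂ - ε) x₂) ≤ infOn f x₁ (x₂ - ε)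

/-- The vertex set `εℤ + εϑ`. -/
def vertices (ε ϑ : ℝ) : Set ℝ := {x | ∃ k : ℤ, x = ε * k + ε * ϑ}

/-- For `x₁ < x₂`, whether `x₁` and `x₂` are joined by an edge with label `b`. The label `false`
is that of the first edge, present if the adjacency condition holds for `ℓ` or for `r`;
the label `true` is that of the second edge, present if `x₂ ≠ x₁ + ε` and the condition holds for
both `ℓ` and `r`. -/
def HasEdge (ℓ r : ℝ → ℝ) (ε x₁ x₂ : ℝ) (b : Bool) : Prop :=
  (b = false ∧ (CellAdj ℓ ε x₁ x₂ ∨ CellAdj r ε x₁ x₂)) ∨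
  (b = true ∧ x₂ ≠ x₁ + ε ∧ CellAdj ℓ ε x₁ x₂ ∧ CellAdj r ε x₁ x₂)

/-- The `ε`-mated-CRT map with the topology of the plane associated with the pair of paths `(ℓ, r)`
with index shift `εϑ`, as a multigraph. The edge `(x₁, x₂, b)`, with `x₁ < x₂`, joins
the vertices `x₁` and `x₂`, and `b` numbers the at most two parallel edges. -/
def matedCRTMap (ℓ r : ℝ → ℝ) (ε ϑ : ℝ) : Graph ℝ (ℝ × ℝ × Bool) where
  vertexSet := vertices ε ϑ
  IsLink e x y :=
    ((e.1 = x ∧ e.2.1 = y) ∨ (e.1 = y ∧ e.2.1 = x)) ∧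
      e.1 ∈ vertices ε ϑ ∧ e.2.1 ∈ vertices ε ϑ ∧ e.1 < e.2.1 ∧ HasEdge ℓ r ε e.1 e.2.1 e.2.2
  isLink_symm := fun _ _ => ⟨fun _ _ h => ⟨h.1.symm, h.2⟩⟩
  eq_or_eq_of_isLink_of_isLink := by
    rintro e x y v w ⟨h, -⟩ ⟨h', -⟩
    grind
  left_mem_of_isLink := by
    rintro e x y ⟨⟨rfl, rfl⟩ | ⟨rfl, rfl⟩, h₁, h₂, -⟩
    · exact h₁
    · exact h₂

/-- The degree of `x` in the multigraph `G`, for `G` without loops: the number (possibly infinite)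
of edges with `x` as an endpoint. -/
noncomputable def deg {α β : Type*} (x : α) (G : Graph α β) : ℕ∞ := {e | G.Inc e x}.encard

end MatedCRT

/-! Centre and rescale one path at a vertex, reversing time for neighbours on the left. The
neighbours on one side that come from this path then correspond to the integers k ≥ 0 such that a
Brownian motion B reaches its running minimum M_k over [0, k] during [k, k + 1] (a record), while
M_k is still at least the minimum over [-1, 0]. A large degree forces one of four such counts (two
paths, two sides) to be large, so an exponential tail for a single count suffices, and each
coordinate is treated separately as a standard Brownian motion.

At a record k the path touches M_k, so with conditional probability at least p = `dropProb` it is at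
most M_k - 1 at time k + 2 (`gaussian_mul_le_of_le`, a strong Markov argument by discretisation).
The second record after k starts no earlier than k + 2. Hence the expectation of the exponential of
the running minimum at record number m contracts by `decayRate` = 1 - p(1 - 1/e) every two records
(`IsTwoSidedBM.recordMoment_add_two_le`).

If more than m records are counted, then either the minimum over [-1, 0] is at most -b, which has
probability at most exp(-b)/p, or the running minimum at record number m is at least -b, which
Markov's inequality bounds by exp(b) times the moment. Taking b proportional to m gives
`IsTwoSidedBM.measure_lt_encard_le_exp`. This estimate is uniform over deterministic vertices, so
independence of θ and Fubini transfer it to the conditional probability. -/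

namespace MatedCRT

open Set Filter Topology
open scoped ENNReal NNReal

/-! ### Infima of continuous paths over compact intervals -/

section InfOn

variable {f : ℝ → ℝ} {a b : ℝ}

lemma exists_infOn_eq (hf : Continuous f) (hab : a ≤ b) : ∃ t ∈ Icc a b, f t = infOn f a b :=
  let ⟨t, ht, h, _⟩ := (isCompact_Icc (a := a) (b := b)).exists_sInf_image_eq_and_le
    (nonempty_Icc.2 hab) hf.continuousOn
  ⟨t, ht, h.symm⟩

lemma infOn_le (hf : Continuous f) {t : ℝ} (ht : t ∈ Icc a b) : infOn f a b ≤ f t :=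
  csInf_le (isCompact_Icc.bddBelow_image hf.continuousOn) (mem_image_of_mem f ht)

lemma le_infOn_iff (hf : Continuous f) (hab : a ≤ b) {c : ℝ} :
    c ≤ infOn f a b ↔ ∀ t ∈ Icc a b, c ≤ f t := by
  refine ⟨fun h t ht => h.trans (infOn_le hf ht), fun h => ?_⟩
  obtain ⟨t, ht, hte⟩ := exists_infOn_eq hf hab
  exact hte ▸ h t ht

lemma infOn_lt_iff (hf : Continuous f) (hab : a ≤ b) {c : ℝ} :
    infOn f a b < c ↔ ∃ t ∈ Icc a b, f t < c := by
  simpa [and_assoc] using (le_infOn_iff hf hab (c := c)).not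

lemma infOn_anti (hf : Continuous f) {a' b' : ℝ} (ha : a' ≤ a) (hab : a ≤ b) (hb : b ≤ b') :
    infOn f a' b' ≤ infOn f a b :=
  (le_infOn_iff hf hab).2 fun _ ht => infOn_le hf ⟨ha.trans ht.1, ht.2.trans hb⟩

/-- Infima of continuous paths over compact intervals are measurable functions. -/
lemma measurable_infOn {Ω : Type*} {m : MeasurableSpace Ω} {u : ℝ → Ω → ℝ} (hab : a ≤ b)
    (hc : ∀ ω, Continuous fun t => u t ω) (hm : ∀ t ∈ Icc a b, Measurable (u t)) :
    Measurable fun ω => infOn (fun t => u t ω) a b := by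
  refine measurable_of_Ici fun c => ?_
  have : Nonempty (Icc a b) := ⟨⟨a, le_rfl, hab⟩⟩
  have h : (fun ω => infOn (fun t => u t ω) a b) ⁻¹' Ici c =
      ⋂ n, {ω | c ≤ u (TopologicalSpace.denseSeq (Icc a b) n) ω} := by
    ext ω
    simp only [mem_preimage, mem_Ici, le_infOn_iff (hc ω) hab, mem_iInter, mem_ofPred_eq]
    refine ⟨fun h n => h _ (Subtype.coe_prop _), fun h t ht => ?_⟩
    have hcl : IsClosed {s : Icc a b | c ≤ u s ω} :=
      isClosed_le continuous_const ((hc ω).comp continuous_subtype_val)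
    have := hcl.closure_subset_iff.2 (range_subset_iff.2 h)
      ((TopologicalSpace.denseRange_denseSeq (Icc a b)) ⟨t, ht⟩)
    exact this
  rw [h]
  exact MeasurableSet.iInter fun n => measurableSet_le measurable_const (hm _ (Subtype.coe_prop _))

end InfOn

/-! ### The past of a Brownian motion and its independent increments -/

section Past

variable {Ω : Type*}

/-- The σ-algebra generated by the path `X` up to time `s`. -/
@[reducible] def past (X : ℝ≥0 → Ω → ℝ) (s : ℝ≥0) : MeasurableSpace Ω :=
  MeasurableSpace.comap (fun ω (t : Iic s) => X t ω) inferInstance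

lemma measurable_past (X : ℝ≥0 → Ω → ℝ) {s t : ℝ≥0} (h : t ≤ s) : Measurable[past X s] (X t) := by
  have := (measurable_pi_apply (⟨t, h⟩ : Iic s)).comp
    (comap_measurable (fun ω (t : Iic s) => X t ω) (m := inferInstance))
  exact this

lemma past_mono (X : ℝ≥0 → Ω → ℝ) {s t : ℝ≥0} (h : s ≤ t) : past X s ≤ past X t := by
  refine Measurable.comap_le ?_
  exact @measurable_pi_lambda _ _ _ (past X t) _ _
    fun r => measurable_past X (le_trans r.2 h)

variable {mΩ : MeasurableSpace Ω} {μ : Measure Ω} {X : ℝ≥0 → Ω → ℝ}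

lemma past_le (hX : ∀ t, Measurable (X t)) (s : ℝ≥0) : past X s ≤ mΩ :=
  Measurable.comap_le (measurable_pi_lambda _ fun _ => hX _)

lemma indep_past_increment (hB : IsPreBrownianReal X μ) (s t : ℝ≥0) :
    Indep (past X s) (MeasurableSpace.comap (fun ω => X (s + t) ω - X s ω) inferInstance) μ := by
  have h := (hB.indepFun_shift s).symm.comp (φ := id) (ψ := fun f : ℝ≥0 → ℝ => f t) measurable_id
    (measurable_pi_apply (X := fun _ : ℝ≥0 => ℝ) t)
  exact h

end Past

/-! ### Gaussian lower tails -/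

section Gaussian

lemma gaussianReal_Iic_pos (c : ℝ) : 0 < gaussianReal 0 1 (Iic c) := by
  refine pos_iff_ne_zero.2 fun h => ?_
  have := gaussianReal_absolutelyContinuous' 0 one_ne_zero h
  simp at this

/-- Scaling by √v ≥ 1 maps the half-line below c ≤ 0 into itself. This yields one lower bound valid
for all increments over a time of length at least 1. -/
lemma gaussianReal_Iic_le {v : ℝ≥0} (hv : 1 ≤ v) {c : ℝ} (hc : c ≤ 0) :
    gaussianReal 0 1 (Iic c) ≤ gaussianReal 0 v (Iic c) := by
  have h := gaussianReal_map_const_mul (μ := 0) (v := 1) (Real.sqrt v)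
  have hs : NNReal.mk (Real.sqrt v ^ 2) (sq_nonneg _) * 1 = v := by
    ext; simp
  rw [mul_zero, hs] at h
  rw [← h, Measure.map_apply (by fun_prop) measurableSet_Iic]
  refine measure_mono fun x hx => ?_
  have h1 : (1 : ℝ) ≤ Real.sqrt v := Real.one_le_sqrt.2 (by exact_mod_cast hv)
  simp only [mem_Iic, mem_preimage] at hx ⊢
  nlinarith

end Gaussian

/-! ### A large drop after hitting a level -/

section Hitting

variable {Ω : Type*} {mΩ : MeasurableSpace Ω} {μ : Measure Ω} {X : ℝ≥0 → Ω → ℝ}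

/-- The Markov property at a fixed time. A density measurable with respect to the past does not
disturb the independence of the next increment; later it carries the exponential of the running
minimum. -/
lemma gaussian_mul_le_inter_increment (hB : IsPreBrownianReal X μ) (hX : ∀ t, Measurable (X t))
    {s t : ℝ≥0} (ht : 1 ≤ t) {c : ℝ} (hc : c ≤ 0) {Y : Ω → ℝ≥0∞} (hY : Measurable[past X s] Y)
    {A : Set Ω} (hA : MeasurableSet[past X s] A) :
    gaussianReal 0 1 (Iic c) * μ.withDensity Y A ≤
      μ.withDensity Y (A ∩ {ω | X (s + t) ω - X s ω ≤ c}) := by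
  set I : Set Ω := {ω | X (s + t) ω - X s ω ≤ c}
  have hAm := past_le hX s _ hA
  have hIm : MeasurableSet I := measurableSet_le ((hX _).sub (hX _)) measurable_const
  have hIm' : MeasurableSet[MeasurableSpace.comap (fun ω => X (s + t) ω - X s ω) inferInstance] I :=
    ⟨Iic c, measurableSet_Iic, rfl⟩
  have hlaw : μ I = gaussianReal 0 t (Iic c) := by
    have h := (hB.hasLaw_sub (s + t) s).measure_eq (p := (· ∈ Iic c)) measurableSet_Iic
    have hd : nndist ((s + t : ℝ≥0) : ℝ) s = t := by
      ext; simp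
    exact h.trans (congrArg (fun v => gaussianReal 0 v (Iic c)) hd)
  have key := lintegral_mul_eq_lintegral_mul_lintegral_of_independent_measurableSpace
    (past_le hX s) (Measurable.comap_le ((hX _).sub (hX _))) (indep_past_increment hB s t)
    (hY.indicator hA) (measurable_const.indicator hIm' (f := fun _ => (1 : ℝ≥0∞)))
  rw [lintegral_indicator hAm, lintegral_indicator hIm, lintegral_one,
    Measure.restrict_apply_univ, hlaw] at key
  have hint : (fun ω => A.indicator Y ω * I.indicator (fun _ => (1 : ℝ≥0∞)) ω) =
      (A ∩ I).indicator Y := by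
    ext ω
    by_cases h1 : ω ∈ A <;> by_cases h2 : ω ∈ I <;> simp [h1, h2]
  rw [hint, lintegral_indicator (hAm.inter hIm)] at key
  rw [withDensity_apply _ hAm, withDensity_apply _ (hAm.inter hIm), key, mul_comm]
  exact mul_le_mul_right (gaussianReal_Iic_le ht hc) _

/-- If the path is below the level `h` at one of finitely many times in `[s, s + 1]`, then with
probability bounded from below it is well below `h` at time `s + 2`. -/
lemma gaussian_mul_le_of_grid (hB : IsPreBrownianReal X μ) (hX : ∀ t, Measurable (X t))
    {s : ℝ≥0} {τ : ℕ → ℝ≥0} (hτ : Monotone τ) (hs : ∀ i, s ≤ τ i) {N : ℕ} (hN : ∀ i < N, τ i ≤ s + 1)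
    {Y : Ω → ℝ≥0∞} (hY : Measurable[past X s] Y) {h : Ω → ℝ} (hh : Measurable[past X s] h)
    {c : ℝ} (hc : c ≤ 0) :
    gaussianReal 0 1 (Iic c) * μ.withDensity Y (⋃ i ∈ Finset.range N, {ω | X (τ i) ω < h ω}) ≤
      μ.withDensity Y ((⋃ i ∈ Finset.range N, {ω | X (τ i) ω < h ω}) ∩
        {ω | X (s + 2) ω ≤ h ω + c}) := by
  set U : ℕ → Set Ω := fun i => {ω | X (τ i) ω < h ω}
  set ν := μ.withDensity Y
  -- `A i` is the event that `τ i` is the first grid time below level `h`. It depends on the path up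
  -- to `τ i` only, so the Markov property applies separately on each of these disjoint events.
  set A : ℕ → Set Ω := disjointed U with hA
  have hUm (i : ℕ) : MeasurableSet[past X (τ i)] (U i) :=
    measurableSet_lt (mδ := past X (τ i)) (measurable_past X le_rfl)
      (hh.mono (past_mono X (hs i)) le_rfl)
  have hAm (i : ℕ) : MeasurableSet[past X (τ i)] (A i) := by
    rw [hA, disjointed_eq_inter_compl]
    refine MeasurableSet.inter (hUm i) (MeasurableSet.iInter fun j => MeasurableSet.iInter fun hj => ?_)
    exact (past_mono X (hτ hj.le) _ (hUm j)).compl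
  have hAU (i : ℕ) : A i ⊆ U i := disjointed_subset U i
  have hUA : (⋃ i ∈ Finset.range N, U i) = ⋃ i ∈ Finset.range N, A i := by
    obtain _ | N := N
    · simp
    · rw [hA, biUnion_range_succ_disjointed, partialSups_eq_biSup]
      simp
  have hdisj : (Finset.range N : Set ℕ).PairwiseDisjoint A :=
    fun i _ j _ hij => disjoint_disjointed U hij
  rw [hUA, measure_biUnion_finset hdisj fun i _ => past_le hX _ _ (hAm i), Finset.mul_sum]
  have hstep : ∀ i ∈ Finset.range N, gaussianReal 0 1 (Iic c) * ν (A i) ≤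
      ν (A i ∩ {ω | X (s + 2) ω ≤ h ω + c}) := by
    intro i hi
    have hi' := hN i (Finset.mem_range.1 hi)
    obtain ⟨t, ht⟩ : ∃ t, s + 2 = τ i + t := exists_add_of_le (hi'.trans (by gcongr; norm_num))
    have ht1 : 1 ≤ t := by
      have : s + 1 + 1 ≤ s + 1 + t := by
        calc s + 1 + 1 = s + 2 := by ring
          _ = τ i + t := ht
          _ ≤ s + 1 + t := by gcongr
      exact le_of_add_le_add_left this
    refine (gaussian_mul_le_inter_increment hB hX ht1 hc
      (hY.mono (past_mono X (hs i)) le_rfl) (hAm i)).trans (measure_mono ?_)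
    rintro ω ⟨h1, h2⟩
    refine ⟨h1, ?_⟩
    have h3 : X (τ i) ω < h ω := hAU i h1
    simp only [mem_ofPred_eq, ht] at h2 ⊢
    linarith
  refine (Finset.sum_le_sum hstep).trans ?_
  have hdisj' : (Finset.range N : Set ℕ).PairwiseDisjoint
      fun i => A i ∩ {ω | X (s + 2) ω ≤ h ω + c} :=
    fun i hi j hj hij => (hdisj hi hj hij).mono inter_subset_left inter_subset_left
  rw [← measure_biUnion_finset hdisj' fun i _ => (past_le hX _ _ (hAm i)).inter
    (measurableSet_le (hX _) ((hh.mono (past_le hX s) le_rfl).add_const c)), iUnion₂_inter]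

/-- Being strictly below `h` is an open condition on time, so a continuous path that does this in
the interval also does it at a point of every sufficiently fine grid. The grid estimate passes to
the increasing union. -/
lemma gaussian_mul_le_of_lt (hB : IsPreBrownianReal X μ) (hX : ∀ t, Measurable (X t))
    (hc : ∀ ω, Continuous fun t => X t ω) {s : ℝ≥0} {Y : Ω → ℝ≥0∞} (hY : Measurable[past X s] Y)
    {h : Ω → ℝ} (hh : Measurable[past X s] h) {c : ℝ} (hc0 : c ≤ 0) :
    gaussianReal 0 1 (Iic c) * μ.withDensity Y {ω | ∃ t ∈ Icc s (s + 1), X t ω < h ω} ≤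
      μ.withDensity Y ({ω | ∃ t ∈ Icc s (s + 1), X t ω < h ω} ∩ {ω | X (s + 2) ω ≤ h ω + c}) := by
  set H : Set Ω := {ω | ∃ t ∈ Icc s (s + 1), X t ω < h ω}
  -- For `n = 0` division by zero gives 0, and the grid is the single point `s`.
  let τ : ℕ → ℕ → ℝ≥0 := fun n i => s + i / n
  let U : ℕ → Set Ω := fun n => ⋃ i ∈ Finset.range (n + 1), {ω | X (τ n i) ω < h ω}
  have hτ1 (n i : ℕ) (hi : i < n + 1) : τ n i ≤ s + 1 := by
    have : (i / n : ℝ≥0) ≤ 1 := div_le_one_of_le₀ (by exact_mod_cast Nat.lt_succ_iff.1 hi) (by simp)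
    simp only [τ]
    gcongr
  have hUH (n : ℕ) : U n ⊆ H := by
    intro ω hω
    simp only [U, mem_iUnion, Finset.mem_range] at hω
    obtain ⟨i, hi, hω⟩ := hω
    exact ⟨τ n i, ⟨by simp [τ], hτ1 n i hi⟩, hω⟩
  have hU (n : ℕ) : gaussianReal 0 1 (Iic c) * μ.withDensity Y (U n) ≤
      μ.withDensity Y (H ∩ {ω | X (s + 2) ω ≤ h ω + c}) := by
    refine (gaussian_mul_le_of_grid hB hX (τ := τ n) ?_ ?_ (hτ1 n) hY hh hc0).trans
      (measure_mono (inter_subset_inter_left _ (hUH n)))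
    · intro i j hij
      simp only [τ]
      gcongr
    · simp [τ]
  have hHU : H ⊆ ⋃ N, ⋂ n, ⋂ (_ : N ≤ n), U n := by
    rintro ω ⟨t, ⟨hst, hts⟩, hω⟩
    obtain ⟨r, rfl⟩ := exists_add_of_le hst
    have hr : r ≤ 1 := le_of_add_le_add_left hts
    have hlim : Tendsto (fun n : ℕ => τ n ⌊r * n⌋₊) atTop (𝓝 (s + r)) := by
      simp only [τ]
      refine tendsto_const_nhds.add ?_
      rw [← NNReal.tendsto_coe]
      have h := (tendsto_nat_floor_mul_div_atTop (R := ℝ) r.2).comp tendsto_natCast_atTop_atTop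
      refine h.congr fun n => ?_
      simp only [Function.comp_apply, NNReal.coe_div, NNReal.coe_natCast]
      congr 2
    have hev := (((hc ω).tendsto _).comp hlim).eventually_lt_const hω
    obtain ⟨N, hN⟩ := eventually_atTop.1 hev
    refine mem_iUnion.2 ⟨N, mem_iInter₂.2 fun n hn => ?_⟩
    simp only [U, mem_iUnion, Finset.mem_range]
    refine ⟨⌊r * n⌋₊, ?_, hN n hn⟩
    refine Nat.lt_succ_iff.2 (Nat.floor_le_of_le ?_)
    calc r * n ≤ 1 * n := by gcongr
      _ = n := one_mul _
  have hmono : Monotone fun N => ⋂ n, ⋂ (_ : N ≤ n), U n := by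
    intro N N' hN ω hω
    simp only [mem_iInter] at hω ⊢
    exact fun n hn => hω n (hN.trans hn)
  calc gaussianReal 0 1 (Iic c) * μ.withDensity Y H
      ≤ gaussianReal 0 1 (Iic c) * μ.withDensity Y (⋃ N, ⋂ n, ⋂ (_ : N ≤ n), U n) := by gcongr
    _ = ⨆ N, gaussianReal 0 1 (Iic c) * μ.withDensity Y (⋂ n, ⋂ (_ : N ≤ n), U n) := by
        rw [hmono.measure_iUnion, ENNReal.mul_iSup]
    _ ≤ _ := iSup_le fun N => le_trans (by gcongr; exact iInter₂_subset N le_rfl) (hU N)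

/-- If the path reaches the level `h` during `[s, s + 1]`, then with probability bounded from below
it is below `h - 1` at time `s + 2`. -/
lemma gaussian_mul_le_of_le (hB : IsPreBrownianReal X μ) (hX : ∀ t, Measurable (X t))
    (hc : ∀ ω, Continuous fun t => X t ω) {s : ℝ≥0} {Y : Ω → ℝ≥0∞} (hY : Measurable[past X s] Y)
    (hYi : ∫⁻ ω, Y ω ∂μ ≠ ∞) {h : Ω → ℝ} (hh : Measurable[past X s] h) {m : Ω → ℝ}
    (hmm : Measurable m) (hm : ∀ ω c, m ω < c ↔ ∃ t ∈ Icc s (s + 1), X t ω < c) :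
    gaussianReal 0 1 (Iic (-2)) * μ.withDensity Y {ω | m ω ≤ h ω} ≤
      μ.withDensity Y ({ω | m ω ≤ h ω} ∩ {ω | X (s + 2) ω ≤ h ω - 1}) := by
  have := isFiniteMeasure_withDensity hYi
  have hhm := hh.mono (past_le hX s) le_rfl
  -- The weak inequality is the limit of strict ones at level `h + δ n`. As `δ n ≤ 1`, a drop of 2
  -- from there ends at most at `h - 1`.
  let δ : ℕ → ℝ := fun n => 1 / (n + 1)
  have hδ0 (n : ℕ) : 0 < δ n := Nat.one_div_pos_of_nat
  have hδ1 (n : ℕ) : δ n ≤ 1 := by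
    simpa [δ] using Nat.one_div_le_one_div (α := ℝ) (Nat.zero_le n)
  let E : ℕ → Set Ω := fun n => {ω | m ω < h ω + δ n} ∩ {ω | X (s + 2) ω ≤ h ω - 1}
  have hE (n : ℕ) : gaussianReal 0 1 (Iic (-2)) * μ.withDensity Y {ω | m ω ≤ h ω} ≤
      μ.withDensity Y (E n) := by
    have h1 := gaussian_mul_le_of_lt hB hX hc hY (h := fun ω => h ω + δ n) (hh.add_const (δ n))
      (c := -2) (by norm_num)
    simp only [← hm] at h1
    refine le_trans ?_ (h1.trans (measure_mono (inter_subset_inter_right _ ?_)))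
    · refine mul_le_mul_right (measure_mono fun ω hω => ?_) _
      simp only [mem_ofPred_eq] at hω ⊢
      linarith [hδ0 n]
    · intro ω hω
      simp only [mem_ofPred_eq] at hω ⊢
      linarith [hδ1 n]
  have hEI : {ω | m ω ≤ h ω} ∩ {ω | X (s + 2) ω ≤ h ω - 1} = ⋂ n, E n := by
    ext ω
    simp only [E, mem_inter_iff, mem_iInter, mem_ofPred_eq, forall_and, forall_const]
    refine and_congr_left fun _ => ⟨fun h' n => by linarith [hδ0 n], fun h' => ?_⟩
    refine ge_of_tendsto' (x := atTop) (f := fun n : ℕ => h ω + δ n) ?_ fun n => (h' n).le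
    simpa [δ] using (tendsto_one_div_add_atTop_nhds_zero_nat (𝕜 := ℝ)).const_add (h ω)
  rw [hEI]
  refine ge_of_tendsto' (tendsto_measure_iInter_atTop (fun n => ?_) ?_ ⟨0, measure_ne_top _ _⟩) hE
  · exact ((measurableSet_lt hmm (hhm.add_const _)).inter
      (measurableSet_le (hX _) (hhm.sub_const 1))).nullMeasurableSet
  · intro n n' hn ω hω
    refine ⟨?_, hω.2⟩
    have : δ n' ≤ δ n := Nat.one_div_le_one_div hn
    have := hω.1
    simp only [mem_ofPred_eq] at this ⊢
    linarith

end Hitting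

/-! ### Records of a path and their numbering -/

/-- The path `f` attains during `[k, k + 1]` its minimum over `[0, k + 1]`. -/
def IsRecord (f : ℝ → ℝ) (k : ℕ) : Prop := infOn f k (k + 1) ≤ infOn f 0 k

open scoped Classical in
/-- The number of records before `k`. -/
noncomputable def recordCount (f : ℝ → ℝ) (k : ℕ) : ℕ := Nat.count (IsRecord f) k

lemma infOn_zero_anti {f : ℝ → ℝ} (hf : Continuous f) {j k : ℕ} (h : j ≤ k) :
    infOn f 0 k ≤ infOn f 0 j :=
  infOn_anti hf le_rfl (Nat.cast_nonneg j) (by exact_mod_cast h)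

lemma eq_of_recordCount_eq {f : ℝ → ℝ} {j k : ℕ} (hj : IsRecord f j) (hk : IsRecord f k)
    (h : recordCount f j = recordCount f k) : j = k := by
  classical exact Nat.count_injective hj hk h

lemma exists_record_of_lt_recordCount {f : ℝ → ℝ} {k m : ℕ} (h : m < recordCount f k) :
    ∃ j < k, IsRecord f j ∧ recordCount f j = m := by
  classical
  have hcard : ∀ hf : (Set.ofPred (IsRecord f)).Finite, m < hf.toFinset.card :=
    fun hf => h.trans_le (Nat.count_le_card hf k)
  exact ⟨Nat.nth (IsRecord f) m, Nat.nth_lt_of_lt_count h, Nat.nth_mem m hcard, Nat.count_nth hcard⟩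

/-- The count grows by at most one per step. Two further records therefore leave time for the drop
observed at time `j + 2`. -/
lemma add_two_le_of_recordCount {f : ℝ → ℝ} {j k m : ℕ} (hj : recordCount f j = m)
    (hk : recordCount f k = m + 2) : j + 2 ≤ k := by
  classical
  have h := Nat.count_add (IsRecord f) j (k - j)
  unfold recordCount at hj hk
  rcases le_total j k with hjk | hjk
  · rw [Nat.add_sub_cancel' hjk, hj, hk] at h
    have := Nat.count_le (p := fun i => IsRecord f (j + i)) (n := k - j)
    omega
  · have := Nat.count_monotone (IsRecord f) hjk
    omega

/-! ### Tail of the number of records -/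

section TwoSided

variable {Ω : Type*} {mΩ : MeasurableSpace Ω} {μ : Measure Ω} {B : ℝ → Ω → ℝ}

/-- A process with continuous paths, vanishing at time `0`, whose restrictions to positive and to
negative times are Brownian motions. -/
structure IsTwoSidedBM (B : ℝ → Ω → ℝ) (μ : Measure Ω) : Prop where
  measurable : ∀ t, Measurable (B t)
  continuous : ∀ ω, Continuous fun t => B t ω
  zero : ∀ ω, B 0 ω = 0
  forward : IsPreBrownianReal (fun t : ℝ≥0 => B t) μ
  backward : IsPreBrownianReal (fun t : ℝ≥0 => B (-t)) μ

/-- The lower bound on the probability that a Brownian motion makes a large downward step. -/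
noncomputable def dropProb : ℝ := (gaussianReal 0 1).real (Iic (-2))

lemma dropProb_pos : 0 < dropProb :=
  ENNReal.toReal_pos (gaussianReal_Iic_pos _).ne' (measure_ne_top _ _)

lemma dropProb_le_one : dropProb ≤ 1 := measureReal_le_one

lemma ofReal_dropProb : ENNReal.ofReal dropProb = gaussianReal 0 1 (Iic (-2)) := ofReal_measureReal

/-- If the path run backwards reaches -c within unit time, it is at most -c - 1 at time 2 with
probability at least `dropProb`. The latter event has probability at most exp(-c - 1) · exp(1) by
Chernoff's bound with variance 2 and parameter -1. -/
lemma IsTwoSidedBM.measure_infOn_le [IsProbabilityMeasure μ] (hB : IsTwoSidedBM B μ) (c : ℝ) :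
    μ.real {ω | infOn (fun t => B t ω) (-1) 0 ≤ -c} ≤ dropProb⁻¹ * Real.exp (-c) := by
  have hm : Measurable fun ω => infOn (fun t => B t ω) (-1) 0 :=
    measurable_infOn (by norm_num) hB.continuous fun t _ => hB.measurable t
  have h1 := gaussian_mul_le_of_le hB.backward (fun t => hB.measurable _)
    (fun ω => (hB.continuous ω).comp (NNReal.continuous_coe.neg)) (s := 0) (Y := 1)
    measurable_const (by simp) (h := fun _ => -c) measurable_const hm fun ω d => by
      rw [infOn_lt_iff (hB.continuous ω) (by norm_num)]
      constructor
      · rintro ⟨t, ht, h⟩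
        have ht0 : 0 ≤ -t := neg_nonneg.2 ht.2
        refine ⟨(-t).toNNReal, ⟨zero_le, ?_⟩, ?_⟩
        · rw [zero_add, Real.toNNReal_le_one]
          linarith [ht.1]
        · rwa [Real.coe_toNNReal _ ht0, neg_neg]
      · rintro ⟨t, ht, h⟩
        have : (t : ℝ) ≤ 1 := by simpa using ht.2
        exact ⟨-t, ⟨by linarith, by simp⟩, h⟩
  rw [withDensity_one] at h1
  have h2 : dropProb * μ.real {ω | infOn (fun t => B t ω) (-1) 0 ≤ -c} ≤
      μ.real {ω | B (-(2 : ℝ≥0)) ω ≤ -c - 1} := by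
    rw [dropProb, measureReal_def, measureReal_def, measureReal_def, ← ENNReal.toReal_mul]
    refine ENNReal.toReal_mono (measure_ne_top _ _) (h1.trans (measure_mono ?_))
    intro ω hω
    simpa using hω.2
  have hlaw := hB.backward.hasLaw_eval 2
  have h3 := measure_le_le_exp_mul_mgf (μ := μ) (X := B (-(2 : ℝ≥0))) (t := -1) (-c - 1)
    (by norm_num) (by
      have := integrable_exp_mul_gaussianReal (μ := 0) (v := 2) (-1)
      rw [← hlaw.map_eq] at this
      exact this.comp_aemeasurable hlaw.aemeasurable)
  rw [mgf_gaussianReal hlaw.map_eq, ← Real.exp_add] at h3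
  have h4 : -(-1) * (-c - 1) + (0 * (-1) + ((2 : ℝ≥0) : ℝ) * (-1) ^ 2 / 2) = -c := by
    simp
  rw [h4] at h3
  rw [inv_mul_eq_div, le_div_iff₀ dropProb_pos, mul_comm]
  exact h2.trans h3

/-- The event that `k` is a record preceded by exactly `m` records. -/
def recordEvent (B : ℝ → Ω → ℝ) (k m : ℕ) : Set Ω :=
  {ω | IsRecord (fun t => B t ω) k ∧ recordCount (fun t => B t ω) k = m}

/-- The expectation of the exponential of the running minimum before record number `m`, on the
event that there is such a record. -/
noncomputable def recordMoment (B : ℝ → Ω → ℝ) (μ : Measure Ω) (m : ℕ) : ℝ≥0∞ :=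
  ∑' k, ∫⁻ ω in recordEvent B k m, ENNReal.ofReal (Real.exp (infOn (fun t => B t ω) 0 k)) ∂μ

lemma IsTwoSidedBM.measurable_past_infOn (hB : IsTwoSidedBM B μ) {a b : ℝ} {s : ℝ≥0} (ha : 0 ≤ a)
    (hab : a ≤ b) (hbs : b ≤ s) :
    Measurable[past (fun t : ℝ≥0 => B t) s] fun ω => infOn (fun t => B t ω) a b := by
  refine measurable_infOn (m := past (fun t : ℝ≥0 => B t) s) hab hB.continuous fun t ht => ?_
  exact measurable_past (fun t : ℝ≥0 => B t) (t := ⟨t, ha.trans ht.1⟩) (ht.2.trans hbs)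

lemma IsTwoSidedBM.measurableSet_isRecord (hB : IsTwoSidedBM B μ) (k : ℕ) :
    MeasurableSet[past (fun t : ℝ≥0 => B t) (k + 1)] {ω | IsRecord (fun t => B t ω) k} :=
  measurableSet_le (mδ := past (fun t : ℝ≥0 => B t) (k + 1))
    (hB.measurable_past_infOn (by positivity) (by simp) (by simp))
    (hB.measurable_past_infOn le_rfl (by positivity) (by simp))

/-- Records before `k` involve the path up to time `k` only, so the count may enter the density in
the hitting estimate at time `k`. -/
lemma IsTwoSidedBM.measurable_recordCount (hB : IsTwoSidedBM B μ) (k : ℕ) :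
    Measurable[past (fun t : ℝ≥0 => B t) k] fun ω => recordCount (fun t => B t ω) k := by
  classical
  induction k with
  | zero => simp [recordCount]
  | succ k ih =>
    simp only [recordCount, Nat.count_succ] at ih ⊢
    rw [Nat.cast_succ]
    refine Measurable.add (m := past (fun t : ℝ≥0 => B t) (k + 1))
      (ih.mono (past_mono _ (by simp)) le_rfl) ?_
    exact Measurable.ite (m := past (fun t : ℝ≥0 => B t) (k + 1)) (hB.measurableSet_isRecord k)
      measurable_const measurable_const

lemma IsTwoSidedBM.measurableSet_recordEvent (hB : IsTwoSidedBM B μ) (k m : ℕ) :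
    MeasurableSet (recordEvent B k m) := by
  have h (s : ℝ≥0) := past_le (X := fun t : ℝ≥0 => B t) (fun t => hB.measurable t) s
  exact (h _ _ (hB.measurableSet_isRecord k)).inter
    (h _ _ (hB.measurable_recordCount k (measurableSet_singleton m)))

/-- The factor by which the moment of the running minimum decreases in two records. -/
noncomputable def decayRate : ℝ := 1 - dropProb * (1 - Real.exp (-1))

lemma decayRate_lt_one : decayRate < 1 := by
  have h : Real.exp (-1) < 1 := Real.exp_lt_one_iff.2 (by norm_num)
  have := mul_pos dropProb_pos (sub_pos.2 h)
  unfold decayRate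
  linarith

lemma decayRate_pos : 0 < decayRate := by
  have := dropProb_le_one
  have := dropProb_pos
  have := Real.exp_pos (-1)
  unfold decayRate
  nlinarith

/-- Being a record at `k` means reaching the running minimum during [k, k + 1]. The hitting
estimate, weighted by the exponential of that minimum and restricted to the given count, says that a
fraction `dropProb` of the mass then loses a factor of at least e by time `k + 2`. -/
lemma IsTwoSidedBM.setLIntegral_exp_le [IsProbabilityMeasure μ] (hB : IsTwoSidedBM B μ)
    (k m : ℕ) :
    ∫⁻ ω in recordEvent B k m,
        ENNReal.ofReal (Real.exp (infOn (fun t => B t ω) 0 ((k + 2 : ℕ) : ℝ))) ∂μ ≤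
      ENNReal.ofReal decayRate * ∫⁻ ω in recordEvent B k m,
        ENNReal.ofReal (Real.exp (infOn (fun t => B t ω) 0 k)) ∂μ := by
  set X : ℝ≥0 → Ω → ℝ := fun t => B t
  have hple (s : ℝ≥0) := past_le (X := X) (fun t => hB.measurable t) s
  set M : Ω → ℝ := fun ω => infOn (fun t => B t ω) 0 k
  set G : Set Ω := {ω | recordCount (fun t => B t ω) k = m}
  set S : Set Ω := {ω | IsRecord (fun t => B t ω) k}
  set T : Set Ω := {ω | B (k + 2) ω ≤ M ω - 1}
  set Y : Ω → ℝ≥0∞ := fun ω => ENNReal.ofReal (Real.exp (M ω))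
  have hMp : Measurable[past X k] M := hB.measurable_past_infOn le_rfl (by positivity) (by simp)
  have hGp : MeasurableSet[past X k] G := hB.measurable_recordCount k (measurableSet_singleton m)
  have hYp : Measurable[past X k] Y :=
    ENNReal.measurable_ofReal.comp (Real.measurable_exp.comp hMp)
  have hG := hple _ _ hGp
  have hS : MeasurableSet S := hple _ _ (hB.measurableSet_isRecord k)
  have hT : MeasurableSet T :=
    measurableSet_le (hB.measurable _) ((hMp.mono (hple _) le_rfl).sub_const 1)
  have hM0 (ω : Ω) : M ω ≤ 0 := by
    have := infOn_le (hB.continuous ω) (a := 0) (b := k) (t := 0) (by simp)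
    rwa [hB.zero] at this
  have hY1 (ω : Ω) : Y ω ≤ 1 := by
    simpa [Y] using hM0 ω
  have hYi : ∫⁻ ω, G.indicator Y ω ∂μ ≠ ∞ := by
    refine ne_top_of_le_ne_top (b := 1) (by simp) ?_
    calc ∫⁻ ω, G.indicator Y ω ∂μ ≤ ∫⁻ _, 1 ∂μ :=
          lintegral_mono fun ω => (indicator_le_self _ _ ω).trans (hY1 ω)
      _ = 1 := by simp
  have key := gaussian_mul_le_of_le hB.forward (fun t => hB.measurable t)
    (fun ω => (hB.continuous ω).comp NNReal.continuous_coe) (hYp.indicator hGp) hYi hMp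
    (m := fun ω => infOn (fun t => B t ω) k (k + 1))
    (measurable_infOn (by simp) hB.continuous fun t _ => hB.measurable t) fun ω c => by
      rw [infOn_lt_iff (hB.continuous ω) (by simp)]
      constructor
      · rintro ⟨t, ht, h⟩
        exact ⟨⟨t, le_trans (by positivity) ht.1⟩, ⟨ht.1, ht.2⟩, h⟩
      · rintro ⟨t, ht, h⟩
        exact ⟨t, ⟨by exact_mod_cast ht.1, by exact_mod_cast ht.2⟩, h⟩
  have hkey : ENNReal.ofReal dropProb * ∫⁻ ω in S ∩ G, Y ω ∂μ ≤ ∫⁻ ω in S ∩ G ∩ T, Y ω ∂μ := by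
    have hST : {ω | infOn (fun t => B t ω) k (k + 1) ≤ M ω} ∩
        {ω | B ((k + 2 : ℝ≥0) : ℝ) ω ≤ M ω - 1} = S ∩ T := by
      simp [S, T, IsRecord, M]
    rw [hST] at key
    change _ * μ.withDensity (G.indicator Y) S ≤ _ at key
    rw [withDensity_apply _ hS, withDensity_apply _ (hS.inter hT), setLIntegral_indicator hG,
      setLIntegral_indicator hG, ← ofReal_dropProb] at key
    rwa [inter_comm G S, inter_comm G (S ∩ T), inter_right_comm] at key
  have hfin (A : Set Ω) : ∫⁻ ω in A, Y ω ∂μ ≠ ∞ := by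
    refine ne_top_of_le_ne_top (b := 1) (by simp) ?_
    calc ∫⁻ ω in A, Y ω ∂μ ≤ ∫⁻ _ in A, 1 ∂μ := lintegral_mono hY1
      _ = μ A := by simp
      _ ≤ 1 := prob_le_one
  change ∫⁻ ω in S ∩ G, _ ∂μ ≤ _ * ∫⁻ ω in S ∩ G, Y ω ∂μ
  have hanti (ω : Ω) : infOn (fun t => B t ω) 0 ((k + 2 : ℕ) : ℝ) ≤ M ω :=
    infOn_zero_anti (hB.continuous ω) (by omega)
  have hsplit (F : Ω → ℝ≥0∞) := (lintegral_inter_add_sdiff (μ := μ) F (S ∩ G) hT).symm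
  have hcalc : ∫⁻ ω in S ∩ G, ENNReal.ofReal
        (Real.exp (infOn (fun t => B t ω) 0 ((k + 2 : ℕ) : ℝ))) ∂μ ≤
      ENNReal.ofReal (Real.exp (-1)) * ∫⁻ ω in S ∩ G ∩ T, Y ω ∂μ +
        ∫⁻ ω in (S ∩ G) \ T, Y ω ∂μ := by
    rw [hsplit]
    refine add_le_add ?_ (lintegral_mono fun ω => ?_)
    · rw [← lintegral_const_mul' _ _ ENNReal.ofReal_ne_top]
      refine setLIntegral_mono' ((hS.inter hG).inter hT) fun ω hω => ?_
      rw [← ENNReal.ofReal_mul (Real.exp_pos _).le, ← Real.exp_add]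
      refine ENNReal.ofReal_le_ofReal (Real.exp_le_exp.2 ?_)
      have h1 := infOn_le (hB.continuous ω) (a := 0) (b := ((k + 2 : ℕ) : ℝ)) (t := k + 2)
        ⟨by positivity, by simp⟩
      have h2 : B (k + 2) ω ≤ M ω - 1 := hω.2
      linarith
    · exact ENNReal.ofReal_le_ofReal (Real.exp_le_exp.2 (hanti ω))
  refine hcalc.trans ?_
  rw [hsplit Y] at hkey ⊢
  -- With x and y the masses on and off `T`, and p = `dropProb`, the bound p(x + y) ≤ x gives x/e +
  -- y ≤ (1 - p(1 - 1/e))(x + y).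
  lift ∫⁻ ω in S ∩ G ∩ T, Y ω ∂μ to ℝ≥0 using hfin _ with x
  lift ∫⁻ ω in (S ∩ G) \ T, Y ω ∂μ to ℝ≥0 using hfin _ with y
  rw [← ENNReal.toReal_le_toReal (by finiteness) (by finiteness)] at hkey ⊢
  simp only [ENNReal.toReal_mul, ENNReal.toReal_add, ENNReal.coe_ne_top, ne_eq, not_false_eq_true,
    ENNReal.mul_eq_top, ENNReal.ofReal_ne_top, and_false, false_and, or_false,
    ENNReal.toReal_ofReal dropProb_pos.le, ENNReal.toReal_ofReal decayRate_pos.le,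
    ENNReal.toReal_ofReal (Real.exp_pos (-1)).le, ENNReal.coe_toReal] at hkey ⊢
  have h1 : Real.exp (-1) < 1 := Real.exp_lt_one_iff.2 (by norm_num)
  unfold decayRate
  nlinarith

/-- Pathwise, at most one term on the left is nonzero. If record number `m + 2` is at `k`, then
record number `m` is at some `j ≤ k - 2`, and the running minimum is nonincreasing. -/
lemma tsum_recordEvent_add_two_le (hB : IsTwoSidedBM B μ) (m : ℕ) (ω : Ω) :
    ∑' k, (recordEvent B k (m + 2)).indicator
        (fun ω => ENNReal.ofReal (Real.exp (infOn (fun t => B t ω) 0 k))) ω ≤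
      ∑' k, (recordEvent B k m).indicator
        (fun ω => ENNReal.ofReal (Real.exp (infOn (fun t => B t ω) 0 ((k + 2 : ℕ) : ℝ)))) ω := by
  by_cases h : ∃ k, ω ∈ recordEvent B k (m + 2)
  · obtain ⟨k, hk⟩ := h
    rw [tsum_eq_single k]
    · obtain ⟨j, -, hj⟩ := exists_record_of_lt_recordCount (m := m) (by rw [hk.2]; omega)
      refine le_trans ?_ (ENNReal.le_tsum j)
      rw [indicator_of_mem hk, indicator_of_mem (show ω ∈ recordEvent B j m from hj)]
      refine ENNReal.ofReal_le_ofReal (Real.exp_le_exp.2 (infOn_zero_anti (hB.continuous ω) ?_))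
      exact add_two_le_of_recordCount hj.2 hk.2
    · intro k' hk'
      refine indicator_of_notMem (fun h => hk' ?_) _
      exact eq_of_recordCount_eq h.1 hk.1 (h.2.trans hk.2.symm)
  · push Not at h
    simp [h]

lemma IsTwoSidedBM.lintegral_tsum_recordEvent (hB : IsTwoSidedBM B μ) (m : ℕ)
    (g : ℕ → ℕ) :
    ∫⁻ ω, ∑' k, (recordEvent B k m).indicator
        (fun ω => ENNReal.ofReal (Real.exp (infOn (fun t => B t ω) 0 (g k)))) ω ∂μ =
      ∑' k, ∫⁻ ω in recordEvent B k m,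
        ENNReal.ofReal (Real.exp (infOn (fun t => B t ω) 0 (g k))) ∂μ := by
  rw [lintegral_tsum]
  · simp_rw [lintegral_indicator (hB.measurableSet_recordEvent _ m)]
  · intro k
    refine Measurable.aemeasurable (Measurable.indicator ?_ (hB.measurableSet_recordEvent _ m))
    exact ENNReal.measurable_ofReal.comp (Real.measurable_exp.comp
      (measurable_infOn (by positivity) hB.continuous fun t _ => hB.measurable t))

lemma IsTwoSidedBM.recordMoment_add_two_le [IsProbabilityMeasure μ] (hB : IsTwoSidedBM B μ)
    (m : ℕ) : recordMoment B μ (m + 2) ≤ ENNReal.ofReal decayRate * recordMoment B μ m := by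
  refine (hB.lintegral_tsum_recordEvent (m + 2) id).symm.trans_le ?_
  refine (lintegral_mono (tsum_recordEvent_add_two_le hB m)).trans ?_
  rw [hB.lintegral_tsum_recordEvent m (· + 2), recordMoment, ← ENNReal.tsum_mul_left]
  exact ENNReal.tsum_le_tsum fun k => hB.setLIntegral_exp_le k m

lemma IsTwoSidedBM.recordMoment_le_one [IsProbabilityMeasure μ] (hB : IsTwoSidedBM B μ)
    (m : ℕ) : recordMoment B μ m ≤ 1 := by
  refine (hB.lintegral_tsum_recordEvent m id).symm.trans_le ?_
  calc _ ≤ ∫⁻ _, 1 ∂μ := lintegral_mono fun ω => ?_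
    _ = 1 := by simp
  by_cases h : ∃ k, ω ∈ recordEvent B k m
  · obtain ⟨k, hk⟩ := h
    dsimp only
    rw [tsum_eq_single k]
    · refine (indicator_le_self _ _ ω).trans ?_
      have := infOn_le (hB.continuous ω) (a := 0) (b := k) (t := 0) (by simp)
      rw [hB.zero] at this
      simpa using this
    · intro k' hk'
      refine indicator_of_notMem (fun h => hk' ?_) _
      exact eq_of_recordCount_eq h.1 hk.1 (h.2.trans hk.2.symm)
  · push Not at h
    simp [h]

lemma IsTwoSidedBM.recordMoment_le [IsProbabilityMeasure μ] (hB : IsTwoSidedBM B μ) (m : ℕ) :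
    recordMoment B μ m ≤ ENNReal.ofReal decayRate ^ (m / 2) := by
  induction m using Nat.twoStepInduction with
  | zero => simpa using hB.recordMoment_le_one 0
  | one => simpa using hB.recordMoment_le_one 1
  | more m ih _ =>
    refine (hB.recordMoment_add_two_le m).trans ?_
    rw [Nat.add_div_right _ two_pos, pow_succ']
    gcongr

/-- The event that there are more than `m` records before the path goes below its minimum over
`[-1, 0]` has exponentially small probability. -/
lemma IsTwoSidedBM.measure_lt_encard_le [IsProbabilityMeasure μ] (hB : IsTwoSidedBM B μ) (m : ℕ)
    (b : ℝ) :
    μ.real {ω | (m : ℕ∞) < {k : ℕ | IsRecord (fun t => B t ω) k ∧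
        infOn (fun t => B t ω) (-1) 0 ≤ infOn (fun t => B t ω) 0 k}.encard} ≤
      dropProb⁻¹ * Real.exp (-b) + Real.exp b * decayRate ^ (m / 2) := by
  set N := {ω | infOn (fun t => B t ω) (-1) 0 ≤ -b}
  set K := ⋃ k, recordEvent B k m ∩ {ω | -b ≤ infOn (fun t => B t ω) 0 k}
  have hsub : {ω | (m : ℕ∞) < {k : ℕ | IsRecord (fun t => B t ω) k ∧
        infOn (fun t => B t ω) (-1) 0 ≤ infOn (fun t => B t ω) 0 k}.encard} ⊆ N ∪ K := by
    intro ω hω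
    by_cases hN : ω ∈ N
    · exact Or.inl hN
    right
    have hN' : -b < infOn (fun t => B t ω) (-1) 0 := not_le.1 hN
    set A : Set ℕ := {k : ℕ | IsRecord (fun t => B t ω) k ∧
        infOn (fun t => B t ω) (-1) 0 ≤ infOn (fun t => B t ω) 0 k}
    have hmA : (m + 1 : ℕ) ≤ A.encard := by
      have : (m : ℕ∞) < A.encard := hω
      exact_mod_cast Order.add_one_le_of_lt this
    obtain ⟨F, hFA, hF⟩ := exists_subset_encard_eq hmA
    have hFfin : F.Finite := finite_of_encard_eq_coe hF
    -- Pigeonhole: distinct records have distinct counts, so `m + 1` of them cannot all have counts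
    -- below `m`.
    have hex : ∃ k ∈ F, m ≤ recordCount (fun t => B t ω) k := by
      by_contra! hlt
      have hinj : InjOn (recordCount (fun t => B t ω)) F := fun i hi j hj hij =>
        eq_of_recordCount_eq (hFA hi).1 (hFA hj).1 hij
      have hmap : MapsTo (recordCount (fun t => B t ω)) F (Iio m) := fun i hi => hlt i hi
      have := encard_le_encard_of_injOn hmap hinj
      rw [hF, encard_eq_coe_toFinset_card] at this
      have h2 : m + 1 ≤ m := by
        rw [toFinset_card, Fintype.card_Iio, Nat.card_Iio] at this
        exact_mod_cast this
      omega
    obtain ⟨k, hk, hmk⟩ := hex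
    have hkA := hFA hk
    obtain ⟨j, hjk, hj⟩ : ∃ j ≤ k, ω ∈ recordEvent B j m := by
      rcases hmk.eq_or_lt with h | h
      · exact ⟨k, le_rfl, hkA.1, h.symm⟩
      · obtain ⟨j, hj, hj'⟩ := exists_record_of_lt_recordCount h
        exact ⟨j, hj.le, hj'⟩
    refine mem_iUnion.2 ⟨j, hj, ?_⟩
    exact (hN'.le.trans hkA.2).trans (infOn_zero_anti (hB.continuous ω) hjk)
  -- Markov's inequality for the exponential of the running minimum, summed over the position of
  -- record number `m`.
  have hK : μ K ≤ ENNReal.ofReal (Real.exp b * decayRate ^ (m / 2)) := by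
    calc μ K ≤ ∑' k, μ (recordEvent B k m ∩ {ω | -b ≤ infOn (fun t => B t ω) 0 k}) :=
          measure_iUnion_le _
      _ ≤ ∑' k, ENNReal.ofReal (Real.exp b) * ∫⁻ ω in recordEvent B k m,
          ENNReal.ofReal (Real.exp (infOn (fun t => B t ω) 0 k)) ∂μ := by
        refine ENNReal.tsum_le_tsum fun k => ?_
        have hmeas : MeasurableSet {ω | -b ≤ infOn (fun t => B t ω) 0 k} :=
          measurableSet_le measurable_const
            (measurable_infOn (by positivity) hB.continuous fun t _ => hB.measurable t)
        rw [← lintegral_const_mul' _ _ ENNReal.ofReal_ne_top]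
        calc μ (recordEvent B k m ∩ {ω | -b ≤ infOn (fun t => B t ω) 0 k})
            = ∫⁻ ω in recordEvent B k m ∩ {ω | -b ≤ infOn (fun t => B t ω) 0 k}, 1 ∂μ := by simp
          _ ≤ ∫⁻ ω in recordEvent B k m ∩ {ω | -b ≤ infOn (fun t => B t ω) 0 k},
              ENNReal.ofReal (Real.exp b) *
                ENNReal.ofReal (Real.exp (infOn (fun t => B t ω) 0 k)) ∂μ := by
            refine setLIntegral_mono' ((hB.measurableSet_recordEvent k m).inter hmeas)
              fun ω hω => ?_
            have h : -b ≤ infOn (fun t => B t ω) 0 k := hω.2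
            rw [← ENNReal.ofReal_mul (Real.exp_pos _).le, ← Real.exp_add, ENNReal.one_le_ofReal]
            exact Real.one_le_exp (by linarith)
          _ ≤ _ := lintegral_mono_set inter_subset_left
      _ = ENNReal.ofReal (Real.exp b) * recordMoment B μ m := by
        rw [ENNReal.tsum_mul_left, recordMoment]
      _ ≤ ENNReal.ofReal (Real.exp b) * ENNReal.ofReal decayRate ^ (m / 2) := by
        gcongr
        exact hB.recordMoment_le m
      _ = _ := by
        rw [← ENNReal.ofReal_pow decayRate_pos.le, ← ENNReal.ofReal_mul (Real.exp_pos _).le]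
  refine (measureReal_mono hsub).trans ((measureReal_union_le N K).trans ?_)
  refine add_le_add (hB.measure_infOn_le b) ?_
  exact ENNReal.toReal_le_of_le_ofReal
    (mul_nonneg (Real.exp_pos _).le (pow_nonneg decayRate_pos.le _)) hK

/-- The prefactor in the tail bound for the number of records. -/
noncomputable def tailConst : ℝ := dropProb⁻¹ + Real.exp (-Real.log decayRate / 2)

/-- The exponential rate in the tail bound for the number of records. -/
noncomputable def tailRate : ℝ := -Real.log decayRate / 4

lemma tailConst_pos : 0 < tailConst := add_pos (inv_pos.2 dropProb_pos) (Real.exp_pos _)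

lemma tailRate_pos : 0 < tailRate := by
  have := Real.log_neg decayRate_pos decayRate_lt_one
  unfold tailRate
  linarith

/-- The choice b = `tailRate` · m balances the two error terms. Rounding in `m / 2` costs the second
summand of `tailConst`. -/
lemma IsTwoSidedBM.measure_lt_encard_le_exp [IsProbabilityMeasure μ] (hB : IsTwoSidedBM B μ)
    (m : ℕ) :
    μ.real {ω | (m : ℕ∞) < {k : ℕ | IsRecord (fun t => B t ω) k ∧
        infOn (fun t => B t ω) (-1) 0 ≤ infOn (fun t => B t ω) 0 k}.encard} ≤
      tailConst * Real.exp (-tailRate * m) := by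
  refine (hB.measure_lt_encard_le m (tailRate * m)).trans ?_
  have h1 : decayRate ^ (m / 2) ≤
      Real.exp (-Real.log decayRate / 2) * Real.exp (Real.log decayRate / 2 * m) := by
    rw [← Real.exp_add]
    nth_rewrite 1 [← Real.exp_log decayRate_pos]
    rw [← Real.exp_nat_mul, Real.exp_le_exp]
    have h2 : (m : ℝ) ≤ 2 * (m / 2 : ℕ) + 1 := by
      exact_mod_cast (by omega : m ≤ 2 * (m / 2) + 1)
    have := Real.log_neg decayRate_pos decayRate_lt_one
    nlinarith
  have h3 : Real.exp (tailRate * m) * (Real.exp (-Real.log decayRate / 2) *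
      Real.exp (Real.log decayRate / 2 * m)) =
      Real.exp (-Real.log decayRate / 2) * Real.exp (-tailRate * m) := by
    simp only [← Real.exp_add, tailRate]
    ring_nf
  calc dropProb⁻¹ * Real.exp (-(tailRate * m)) + Real.exp (tailRate * m) * decayRate ^ (m / 2)
      ≤ dropProb⁻¹ * Real.exp (-(tailRate * m)) + Real.exp (tailRate * m) *
        (Real.exp (-Real.log decayRate / 2) * Real.exp (Real.log decayRate / 2 * m)) := by gcongr
    _ = _ := by rw [h3, ← neg_mul, tailConst, add_mul]

end TwoSided

/-! ### Brownian motion seen from a point, in both time directions -/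

section Line

variable {Ω : Type*} {mΩ : MeasurableSpace Ω} {μ : Measure Ω} {W : ℝ → Ω → ℝ}

/-- A process on the line with continuous paths whose increments are those of a standard
two-sided Brownian motion. -/
structure HasBrownianIncrements (W : ℝ → Ω → ℝ) (μ : Measure Ω) : Prop where
  measurable : ∀ t, Measurable (W t)
  continuous : ∀ ω, Continuous fun t => W t ω
  indep : HasIndepIncrements W μ
  law : ∀ s t, s ≤ t → HasLaw (fun ω => W t ω - W s ω) (gaussianReal 0 (t - s).toNNReal) μ

lemma HasBrownianIncrements.forward (hW : HasBrownianIncrements W μ) (x : ℝ) :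
    IsPreBrownianReal (fun (t : ℝ≥0) ω => W (x + t) ω - W x ω) μ := by
  refine HasIndepIncrements.isPreBrownianReal_of_hasLaw (fun t => ?_) fun n t ht => ?_
  · simpa using hW.law x (x + t) (by simp)
  · have h := hW.indep n (fun i => x + t i) fun i j hij => by simpa using ht hij
    simpa using h

lemma HasBrownianIncrements.backward (hW : HasBrownianIncrements W μ) (x : ℝ) :
    IsPreBrownianReal (fun (t : ℝ≥0) ω => W (x - t) ω - W x ω) μ := by
  refine HasIndepIncrements.isPreBrownianReal_of_hasLaw (fun t => ?_) fun n t ht => ?_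
  · simpa [Pi.neg_def] using gaussianReal_neg (hW.law (x - t) x (by simp))
  · have h := hW.indep n (fun i => x - t i.rev) fun i j hij =>
      sub_le_sub_left (NNReal.coe_le_coe.2 (ht (Fin.rev_le_rev.2 hij))) x
    -- Time reversal reverses the order of the increments and changes their signs.
    have h' := (h.precomp (g := Fin.rev) Fin.rev_injective).comp (fun _ y => -y)
      fun _ => measurable_neg
    convert h' using 2 with i
    ext ω
    simp [Fin.rev_succ, Fin.rev_castSucc]

lemma HasBrownianIncrements.rescale_forward (hW : HasBrownianIncrements W μ) (x : ℝ) {ε : ℝ}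
    (hε : 0 < ε) :
    IsTwoSidedBM (fun t ω => (√ε)⁻¹ * (W (x + ε * t) ω - W x ω)) μ where
  measurable t := ((hW.measurable _).sub (hW.measurable _)).const_mul _
  continuous ω := by
    have := hW.continuous ω
    fun_prop
  zero ω := by simp
  forward := by
    simpa [Real.coe_toNNReal _ hε.le] using
      (hW.forward x).smul (c := ε.toNNReal) (Real.toNNReal_pos.2 hε).ne'
  backward := by
    simpa [Real.coe_toNNReal _ hε.le, sub_eq_add_neg] using
      (hW.backward x).smul (c := ε.toNNReal) (Real.toNNReal_pos.2 hε).ne'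

lemma HasBrownianIncrements.rescale_backward (hW : HasBrownianIncrements W μ) (x : ℝ) {ε : ℝ}
    (hε : 0 < ε) :
    IsTwoSidedBM (fun t ω => (√ε)⁻¹ * (W (x - ε * t) ω - W x ω)) μ where
  measurable t := ((hW.measurable _).sub (hW.measurable _)).const_mul _
  continuous ω := by
    have := hW.continuous ω
    fun_prop
  zero ω := by simp
  forward := by
    simpa [Real.coe_toNNReal _ hε.le] using
      (hW.backward x).smul (c := ε.toNNReal) (Real.toNNReal_pos.2 hε).ne'
  backward := by
    simpa [Real.coe_toNNReal _ hε.le] using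
      (hW.forward x).smul (c := ε.toNNReal) (Real.toNNReal_pos.2 hε).ne'

end Line

/-! ### Adjacency of cells in terms of records -/

section Rescaling

variable {f : ℝ → ℝ} {ε : ℝ}

lemma infOn_rescale_forward (hf : Continuous f) (hε : 0 < ε) {c : ℝ} (hc : 0 < c) (d x : ℝ)
    {a b : ℝ} (hab : a ≤ b) :
    infOn (fun t => c * (f (x + ε * t) - d)) a b =
      c * (infOn f (x + ε * a) (x + ε * b) - d) := by
  refine eq_of_forall_le_iff fun r => ?_
  rw [le_infOn_iff (by fun_prop) hab, ← div_le_iff₀' hc,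
    le_sub_iff_add_le, le_infOn_iff hf (by gcongr)]
  simp only [← div_le_iff₀' hc, le_sub_iff_add_le]
  constructor
  · intro h t ht
    have := h ((t - x) / ε) ⟨by rw [le_div_iff₀' hε]; linarith [ht.1],
      by rw [div_le_iff₀' hε]; linarith [ht.2]⟩
    rwa [mul_div_cancel₀ _ hε.ne', add_sub_cancel] at this
  · intro h t ht
    exact h _ ⟨by gcongr; exact ht.1, by gcongr; exact ht.2⟩

lemma infOn_rescale_backward (hf : Continuous f) (hε : 0 < ε) {c : ℝ} (hc : 0 < c) (d x : ℝ)
    {a b : ℝ} (hab : a ≤ b) :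
    infOn (fun t => c * (f (x - ε * t) - d)) a b =
      c * (infOn f (x - ε * b) (x - ε * a) - d) := by
  refine eq_of_forall_le_iff fun r => ?_
  rw [le_infOn_iff (by fun_prop) hab, ← div_le_iff₀' hc,
    le_sub_iff_add_le, le_infOn_iff hf (by gcongr)]
  simp only [← div_le_iff₀' hc, le_sub_iff_add_le]
  constructor
  · intro h t ht
    have := h ((x - t) / ε) ⟨by rw [le_div_iff₀' hε]; linarith [ht.2],
      by rw [div_le_iff₀' hε]; linarith [ht.1]⟩
    rwa [mul_div_cancel₀ _ hε.ne', sub_sub_cancel] at this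
  · intro h t ht
    exact h _ ⟨by gcongr; exact ht.2, by gcongr; exact ht.1⟩

/-- An increasing affine change of values preserves comparisons of infima. In the new time, the cell
of `x` is [-1, 0], that of the neighbour is [k, k + 1], and the gap between them is [0, k]. -/
lemma cellAdj_right_iff (hf : Continuous f) (hε : 0 < ε) {c : ℝ} (hc : 0 < c) (x : ℝ) (k : ℕ) :
    CellAdj f ε x (x + ε * (k + 1)) ↔ IsRecord (fun t => c * (f (x + ε * t) - f x)) k ∧
      infOn (fun t => c * (f (x + ε * t) - f x)) (-1) 0 ≤
        infOn (fun t => c * (f (x + ε * t) - f x)) 0 k := by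
  unfold IsRecord
  rw [infOn_rescale_forward hf hε hc _ _ (by simp), infOn_rescale_forward hf hε hc _ _ (by simp),
    infOn_rescale_forward hf hε hc _ _ (by simp), mul_le_mul_iff_right₀ hc,
    mul_le_mul_iff_right₀ hc, sub_le_sub_iff_right, sub_le_sub_iff_right, CellAdj, max_le_iff,
    and_comm]
  ring_nf

/-- The origin is now the left end `x - ε` of the cell of `x`, so that this cell becomes [-1, 0]
after time reversal. -/
lemma cellAdj_left_iff (hf : Continuous f) (hε : 0 < ε) {c : ℝ} (hc : 0 < c) (x : ℝ) (k : ℕ) :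
    CellAdj f ε (x - ε * (k + 1)) x ↔
      IsRecord (fun t => c * (f (x - ε - ε * t) - f (x - ε))) k ∧
      infOn (fun t => c * (f (x - ε - ε * t) - f (x - ε))) (-1) 0 ≤
        infOn (fun t => c * (f (x - ε - ε * t) - f (x - ε))) 0 k := by
  unfold IsRecord
  rw [infOn_rescale_backward hf hε hc _ _ (by simp), infOn_rescale_backward hf hε hc _ _ (by simp),
    infOn_rescale_backward hf hε hc _ _ (by simp), mul_le_mul_iff_right₀ hc,
    mul_le_mul_iff_right₀ hc, sub_le_sub_iff_right, sub_le_sub_iff_right, CellAdj, max_le_iff]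
  ring_nf

end Rescaling

/-! ### From the degree to four one-sided counts -/

section Degree

/-- The pair of vertices consisting of `x` and the vertex `k + 1` steps to the right of it
(for `s = true`) or to the left of it (for `s = false`), in increasing order. -/
def cellPair (ε x : ℝ) (s : Bool) (k : ℕ) : ℝ × ℝ :=
  if s then (x, x + ε * (k + 1)) else (x - ε * (k + 1), x)

lemma cellPair_lt {ε : ℝ} (hε : 0 < ε) (x : ℝ) (s : Bool) (k : ℕ) :
    (cellPair ε x s k).1 < (cellPair ε x s k).2 := by
  have : 0 < ε * (k + 1) := by positivity
  cases s <;> simp [cellPair] <;> linarith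

lemma deg_eq_encard {ℓ r : ℝ → ℝ} {ε ϑ x : ℝ} (hε : 0 < ε) (hx : x ∈ vertices ε ϑ) :
    deg x (matedCRTMap ℓ r ε ϑ) = {i : Bool × ℕ × Bool |
      HasEdge ℓ r ε (cellPair ε x i.1 i.2.1).1 (cellPair ε x i.1 i.2.1).2 i.2.2}.encard := by
  set P := {i : Bool × ℕ × Bool |
      HasEdge ℓ r ε (cellPair ε x i.1 i.2.1).1 (cellPair ε x i.1 i.2.1).2 i.2.2}
  set φ : Bool × ℕ × Bool → ℝ × ℝ × Bool :=
    fun i => ((cellPair ε x i.1 i.2.1).1, (cellPair ε x i.1 i.2.1).2, i.2.2)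
  have hφinj : Function.Injective φ := by
    rintro ⟨s, k, b⟩ ⟨s', k', b'⟩ h
    have hk : 0 < ε * ((k : ℝ) + 1) := by positivity
    have hk' : 0 < ε * ((k' : ℝ) + 1) := by positivity
    cases s <;> cases s' <;> simp [φ, cellPair, hε.ne'] at h ⊢
    · exact h
    · linarith [h.1]
    · linarith [h.1]
    · exact h
  rw [deg, ← hφinj.encard_image]
  congr 1
  obtain ⟨j, rfl⟩ := hx
  ext ⟨e₁, e₂, b⟩
  simp only [mem_ofPred_eq, Graph.Inc, matedCRTMap, mem_image]
  constructor
  · rintro ⟨y, hor, h₁, h₂, hlt, hedge⟩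
    obtain ⟨j₁, rfl⟩ := h₁
    obtain ⟨j₂, rfl⟩ := h₂
    have hj : j₁ < j₂ := by
      have : (j₁ : ℝ) < j₂ := lt_of_mul_lt_mul_left (by linarith) hε.le
      exact_mod_cast this
    obtain ⟨k, hk⟩ := Int.le.dest (Int.add_one_le_iff.2 hj)
    have hkr : (j₂ : ℝ) = j₁ + 1 + k := by exact_mod_cast hk.symm
    rcases hor with ⟨h, -⟩ | ⟨-, h⟩
    · refine ⟨(true, k, b), ?_, ?_⟩
      · simp only [P, cellPair, mem_ofPred_eq, if_true]
        rw [← h]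
        convert hedge using 1
        rw [hkr]; ring
      · simp only [φ, cellPair, if_true, Prod.mk.injEq, and_true]
        refine ⟨h.symm, ?_⟩
        rw [← h, hkr]; ring
    · have h1 : ε * j + ε * ϑ - ε * (k + 1) = ε * j₁ + ε * ϑ := by
        rw [← h, hkr]; ring
      refine ⟨(false, k, b), ?_, ?_⟩
      · simp only [P, cellPair, mem_ofPred_eq, Bool.false_eq_true, if_false]
        rwa [h1, ← h]
      · simp only [φ, cellPair, Bool.false_eq_true, if_false, Prod.mk.injEq, and_true]
        exact ⟨h1, h.symm⟩
  · rintro ⟨⟨s, k, b'⟩, hi, heq⟩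
    simp only [φ, Prod.mk.injEq] at heq
    obtain ⟨rfl, rfl, rfl⟩ := heq
    cases s
    · refine ⟨ε * j + ε * ϑ - ε * (k + 1), Or.inr ⟨?_, ?_⟩, ?_, ?_, cellPair_lt hε _ _ _, hi⟩
      · simp [cellPair]
      · simp [cellPair]
      · exact ⟨j - (k + 1), by simp [cellPair]; ring⟩
      · exact ⟨j, by simp [cellPair]⟩
    · refine ⟨ε * j + ε * ϑ + ε * (k + 1), Or.inl ⟨?_, ?_⟩, ?_, ?_, cellPair_lt hε _ _ _, hi⟩
      · simp [cellPair]
      · simp [cellPair]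
      · exact ⟨j, by simp [cellPair]⟩
      · exact ⟨j + (k + 1), by simp [cellPair]; ring⟩

/-- A vertex of large degree has many neighbours on one side, on account of one of the paths. -/
lemma exists_lt_encard_of_lt_encard {ℓ r : ℝ → ℝ} {ε x : ℝ} {n : ℕ}
    (h : (n : ℕ∞) < {i : Bool × ℕ × Bool |
      HasEdge ℓ r ε (cellPair ε x i.1 i.2.1).1 (cellPair ε x i.1 i.2.1).2 i.2.2}.encard) :
    ∃ s : Bool,
      ((n / 8 : ℕ) : ℕ∞) < {k | CellAdj ℓ ε (cellPair ε x s k).1 (cellPair ε x s k).2}.encard ∨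
      ((n / 8 : ℕ) : ℕ∞) < {k | CellAdj r ε (cellPair ε x s k).1 (cellPair ε x s k).2}.encard := by
  -- The divisor 8 accounts for two sides, two paths and two edge labels.
  by_contra! hc
  refine h.not_ge ?_
  let N (s : Bool) : Set ℕ := {k | CellAdj ℓ ε (cellPair ε x s k).1 (cellPair ε x s k).2} ∪
    {k | CellAdj r ε (cellPair ε x s k).1 (cellPair ε x s k).2}
  have hN (s : Bool) : (N s).encard ≤ ((n / 8 + n / 8 : ℕ) : ℕ∞) := by
    refine (encard_union_le _ _).trans ?_
    push_cast
    exact add_le_add (hc s).1 (hc s).2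
  let A (s b : Bool) : Set (Bool × ℕ × Bool) := (fun k => (s, k, b)) '' N s
  have hA (s b : Bool) : (A s b).encard ≤ ((n / 8 + n / 8 : ℕ) : ℕ∞) :=
    (encard_image_le _ _).trans (hN s)
  have hsub : {i : Bool × ℕ × Bool |
      HasEdge ℓ r ε (cellPair ε x i.1 i.2.1).1 (cellPair ε x i.1 i.2.1).2 i.2.2} ⊆
      (A true true ∪ A true false) ∪ (A false true ∪ A false false) := by
    rintro ⟨s, k, b⟩ hi
    have hk : k ∈ N s := by
      rcases hi with ⟨-, h | h⟩ | ⟨-, -, h, -⟩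
      · exact Or.inl h
      · exact Or.inr h
      · exact Or.inl h
    have hmem : (s, k, b) ∈ A s b := mem_image_of_mem _ hk
    cases s <;> cases b <;> simp only [mem_union] <;> tauto
  calc _ ≤ _ := encard_le_encard hsub
    _ ≤ _ := encard_union_le _ _
    _ ≤ _ := add_le_add (encard_union_le _ _) (encard_union_le _ _)
    _ ≤ _ := add_le_add (add_le_add (hA _ _) (hA _ _)) (add_le_add (hA _ _) (hA _ _))
    _ ≤ n := by exact_mod_cast (by omega)

variable {Ω : Type*} {mΩ : MeasurableSpace Ω} {μ : Measure Ω} {W L R : ℝ → Ω → ℝ}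

lemma HasBrownianIncrements.measure_cellAdj_le [IsProbabilityMeasure μ]
    (hW : HasBrownianIncrements W μ) {ε : ℝ} (hε : 0 < ε) (x : ℝ) (s : Bool) (m : ℕ) :
    μ.real {ω | (m : ℕ∞) < {k | CellAdj (fun t => W t ω) ε (cellPair ε x s k).1
      (cellPair ε x s k).2}.encard} ≤ tailConst * Real.exp (-tailRate * m) := by
  have hc : 0 < (√ε)⁻¹ := inv_pos.2 (Real.sqrt_pos.2 hε)
  cases s
  · simpa only [cellPair, Bool.false_eq_true, if_false,
      fun ω => cellAdj_left_iff (hW.continuous ω) hε hc] using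
      (hW.rescale_backward (x - ε) hε).measure_lt_encard_le_exp m
  · simpa only [cellPair, if_true, fun ω => cellAdj_right_iff (hW.continuous ω) hε hc] using
      (hW.rescale_forward x hε).measure_lt_encard_le_exp m

lemma measure_lt_degree_le [IsProbabilityMeasure μ] (hL : HasBrownianIncrements L μ)
    (hR : HasBrownianIncrements R μ) {ε : ℝ} (hε : 0 < ε) (x : ℝ) (n : ℕ) :
    μ.real {ω | (n : ℕ∞) < {i : Bool × ℕ × Bool | HasEdge (fun t => L t ω) (fun t => R t ω) ε
      (cellPair ε x i.1 i.2.1).1 (cellPair ε x i.1 i.2.1).2 i.2.2}.encard} ≤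
      4 * tailConst * Real.exp tailRate * Real.exp (-(tailRate / 8) * n) := by
  let A (W : ℝ → Ω → ℝ) (s : Bool) : Set Ω := {ω | ((n / 8 : ℕ) : ℕ∞) <
    {k | CellAdj (fun t => W t ω) ε (cellPair ε x s k).1 (cellPair ε x s k).2}.encard}
  have hsub : {ω | (n : ℕ∞) < {i : Bool × ℕ × Bool | HasEdge (fun t => L t ω) (fun t => R t ω) ε
      (cellPair ε x i.1 i.2.1).1 (cellPair ε x i.1 i.2.1).2 i.2.2}.encard} ⊆
      (A L true ∪ A L false) ∪ (A R true ∪ A R false) := by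
    intro ω hω
    obtain ⟨s, h | h⟩ := exists_lt_encard_of_lt_encard hω
    · have : ω ∈ A L s := h
      cases s <;> simp only [mem_union] <;> tauto
    · have : ω ∈ A R s := h
      cases s <;> simp only [mem_union] <;> tauto
  have hA {W : ℝ → Ω → ℝ} (hW : HasBrownianIncrements W μ) (s : Bool) :
      μ.real (A W s) ≤ tailConst * Real.exp tailRate * Real.exp (-(tailRate / 8) * n) := by
    refine (hW.measure_cellAdj_le hε x s (n / 8)).trans ?_
    rw [mul_assoc, ← Real.exp_add]
    -- Rounding in `n / 8` costs the factor exp(`tailRate`).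
    have h8 : (n : ℝ) ≤ 8 * (n / 8 : ℕ) + 8 := by
      exact_mod_cast (by omega : n ≤ 8 * (n / 8) + 8)
    have := tailRate_pos
    refine mul_le_mul_of_nonneg_left (Real.exp_le_exp.2 ?_) tailConst_pos.le
    nlinarith
  calc _ ≤ _ := measureReal_mono hsub
    _ ≤ _ := measureReal_union_le _ _
    _ ≤ _ := add_le_add (measureReal_union_le _ _) (measureReal_union_le _ _)
    _ ≤ _ := add_le_add (add_le_add (hA hL _) (hA hL _)) (add_le_add (hA hR _) (hA hR _))
    _ = _ := by ring

end Degree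

/-! ### Joint measurability in the path and the vertex -/

section Measurability

variable {α : Type*} {mα : MeasurableSpace α} {u v : ℝ → α → ℝ}

/-- Moving the endpoints into the integrand reduces random intervals to a fixed one. -/
lemma infOn_eq_infOn_unitInterval {f : ℝ → ℝ} (hf : Continuous f) {a b : ℝ} (hab : a ≤ b) :
    infOn f a b = infOn (fun s => f (a + s * (b - a))) 0 1 := by
  refine eq_of_forall_le_iff fun c => ?_
  rw [le_infOn_iff hf hab, le_infOn_iff (by fun_prop) zero_le_one]
  have hba := sub_nonneg.2 hab
  constructor
  · intro h s hs
    exact h _ ⟨by nlinarith [hs.1], by nlinarith [hs.2]⟩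
  · intro h t ht
    rcases hab.eq_or_lt with rfl | hlt
    · obtain rfl : t = a := le_antisymm ht.2 ht.1
      simpa using h 0 (by simp)
    · have h0 := sub_pos.2 hlt
      have := h ((t - a) / (b - a)) ⟨div_nonneg (sub_nonneg.2 ht.1) hba,
        (div_le_one h0).2 (by linarith [ht.2])⟩
      rwa [div_mul_cancel₀ _ h0.ne', add_sub_cancel] at this

lemma measurable_infOn_of_le (hc : ∀ p, Continuous fun t => u t p) (hm : ∀ t, Measurable (u t))
    {a b : α → ℝ} (ha : Measurable a) (hb : Measurable b) (hab : ∀ p, a p ≤ b p) :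
    Measurable fun p => infOn (fun t => u t p) (a p) (b p) := by
  simp_rw [fun p => infOn_eq_infOn_unitInterval (hc p) (hab p)]
  refine measurable_infOn (u := fun s p => u (a p + s * (b p - a p)) p) zero_le_one
    (fun p => (hc p).comp (by fun_prop)) fun s _ => ?_
  exact (measurable_uncurry_of_continuous_of_measurable hc hm).comp
    ((ha.add ((hb.sub ha).const_mul s)).prodMk measurable_id)

lemma measurableSet_cellAdj (hc : ∀ p, Continuous fun t => u t p) (hm : ∀ t, Measurable (u t))
    {ε : ℝ} (hε : 0 ≤ ε) {x y : α → ℝ} (hx : Measurable x) (hy : Measurable y)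
    (hxy : ∀ p, x p ≤ y p - ε) : MeasurableSet {p | CellAdj (fun t => u t p) ε (x p) (y p)} := by
  refine measurableSet_le ((measurable_infOn_of_le hc hm (hx.sub_const ε) hx ?_).max
    (measurable_infOn_of_le hc hm (hy.sub_const ε) hy ?_))
    (measurable_infOn_of_le hc hm hx (hy.sub_const ε) hxy)
  all_goals exact fun p => sub_le_self _ hε

lemma measurableSet_hasEdge (hcu : ∀ p, Continuous fun t => u t p) (hmu : ∀ t, Measurable (u t))
    (hcv : ∀ p, Continuous fun t => v t p) (hmv : ∀ t, Measurable (v t))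
    {ε : ℝ} (hε : 0 ≤ ε) {x y : α → ℝ} (hx : Measurable x) (hy : Measurable y)
    (hxy : ∀ p, x p ≤ y p - ε) (b : Bool) :
    MeasurableSet {p | HasEdge (fun t => u t p) (fun t => v t p) ε (x p) (y p) b} := by
  have hu := measurableSet_cellAdj hcu hmu hε hx hy hxy
  have hv := measurableSet_cellAdj hcv hmv hε hx hy hxy
  exact ((MeasurableSet.const _).inter (hu.union hv)).union ((MeasurableSet.const _).inter
    ((measurableSet_eq_fun hy (hx.add_const ε)).compl.inter (hu.inter hv)))

lemma measurableSet_lt_encard {ι : Type*} [Countable ι] {P : α → ι → Prop}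
    (hP : ∀ i, MeasurableSet {p | P p i}) (n : ℕ) :
    MeasurableSet {p | (n : ℕ∞) < {i | P p i}.encard} := by
  have h : {p | (n : ℕ∞) < {i | P p i}.encard} =
      ⋃ F : {F : Finset ι // F.card = n + 1}, ⋂ i ∈ F.1, {p | P p i} := by
    ext p
    simp only [mem_ofPred_eq, mem_iUnion, mem_iInter, Subtype.exists]
    constructor
    · intro hlt
      have hle : ((n + 1 : ℕ) : ℕ∞) ≤ {i | P p i}.encard := by
        exact_mod_cast Order.add_one_le_of_lt hlt
      obtain ⟨F, hFP, hF⟩ := exists_subset_encard_eq hle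
      have hfin : F.Finite := finite_of_encard_eq_coe hF
      refine ⟨hfin.toFinset, ?_, fun i hi => hFP (hfin.mem_toFinset.1 hi)⟩
      rw [hfin.encard_eq_coe_toFinset_card] at hF
      exact_mod_cast hF
    · rintro ⟨F, hF, hFP⟩
      calc (n : ℕ∞) < ((n + 1 : ℕ) : ℕ∞) := by exact_mod_cast n.lt_succ_self
        _ = (F : Set ι).encard := by rw [encard_coe_eq_coe_finsetCard, hF]
        _ ≤ _ := encard_le_encard fun i hi => hFP i hi
  rw [h]
  exact MeasurableSet.iUnion fun F => F.1.measurableSet_biInter fun i _ => hP i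

end Measurability

/-! ### Conditioning on an independent variable -/

section Conditioning

lemma condExp_indicator_le_of_forall {Ω : Type*} {m mΩ : MeasurableSpace Ω} {μ : Measure Ω}
    [IsProbabilityMeasure μ] (hm : m ≤ mΩ) {E : Set Ω}
    (hE : NullMeasurableSet E μ) {c : ℝ}
    (h : ∀ A, MeasurableSet[m] A → μ.real (E ∩ A) ≤ c * μ.real A) :
    ∀ᵐ ω ∂μ, (μ⟦E | m⟧) ω ≤ c := by
  have hint : Integrable (E.indicator fun _ => (1 : ℝ)) μ :=
    (integrable_const 1).indicator₀ hE
  refine ae_le_of_ae_le_trim (hm := hm) (f₁ := μ⟦E | m⟧) (f₂ := fun _ => c) ?_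
  refine ae_le_of_forall_setIntegral_le
    (integrable_condExp.trim hm stronglyMeasurable_condExp) (integrable_const c) fun A hA _ => ?_
  rw [← setIntegral_trim hm stronglyMeasurable_condExp hA, setIntegral_condExp hm hint hA,
    setIntegral_const, smul_eq_mul, mul_comm, measureReal_def, trim_measurableSet_eq hm hA,
    ← measureReal_def]
  refine le_trans (le_of_eq ?_) (h A hA)
  rw [integral_indicator₀ (hE.mono_ac Measure.absolutelyContinuous_restrict), setIntegral_const,
    smul_eq_mul, mul_one, measureReal_restrict_apply' (hm _ hA)]

variable {Ω α β : Type*} {mΩ : MeasurableSpace Ω} {μ : Measure Ω} [IsProbabilityMeasure μ]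

/-- Fubini: by independence the joint law is a product, and each section over `A` has measure at
most `c`. -/
lemma _root_.ProbabilityTheory.IndepFun.measureReal_inter_preimage_le {mα : MeasurableSpace α}
    {mβ : MeasurableSpace β} {Φ : Ω → α} {θ : Ω → β} (hind : IndepFun Φ θ μ) (hΦ : Measurable Φ)
    (hθ : Measurable θ) {S : Set (α × β)} (hS : MeasurableSet S) {c : ℝ} (hc : 0 ≤ c)
    (h : ∀ ϑ, μ.real {ω | (Φ ω, ϑ) ∈ S} ≤ c) {A : Set β} (hA : MeasurableSet A) :
    μ.real ({ω | (Φ ω, θ ω) ∈ S} ∩ θ ⁻¹' A) ≤ c * μ.real (θ ⁻¹' A) := by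
  have : IsProbabilityMeasure (μ.map Φ) := Measure.isProbabilityMeasure_map hΦ.aemeasurable
  have : IsProbabilityMeasure (μ.map θ) := Measure.isProbabilityMeasure_map hθ.aemeasurable
  have hSA : MeasurableSet (S ∩ Prod.snd ⁻¹' A) := hS.inter (measurable_snd hA)
  have key : μ ({ω | (Φ ω, θ ω) ∈ S} ∩ θ ⁻¹' A) ≤ ENNReal.ofReal c * μ (θ ⁻¹' A) := by
    calc μ ({ω | (Φ ω, θ ω) ∈ S} ∩ θ ⁻¹' A)
        = μ.map (fun ω => (Φ ω, θ ω)) (S ∩ Prod.snd ⁻¹' A) := by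
          rw [Measure.map_apply (hΦ.prodMk hθ) hSA]
          rfl
      _ = ∫⁻ ϑ, μ.map Φ ((fun f => (f, ϑ)) ⁻¹' (S ∩ Prod.snd ⁻¹' A)) ∂(μ.map θ) := by
          rw [hind.map_prod_eq_prod_map_map hΦ.aemeasurable hθ.aemeasurable,
            Measure.prod_apply_symm hSA]
      _ ≤ ∫⁻ ϑ, A.indicator (fun _ => ENNReal.ofReal c) ϑ ∂(μ.map θ) := by
          refine lintegral_mono fun ϑ => ?_
          by_cases hϑ : ϑ ∈ A
          · rw [indicator_of_mem hϑ, Measure.map_apply hΦ (measurable_prodMk_right hSA)]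
            refine (measure_mono ?_).trans
              ((ENNReal.le_ofReal_iff_toReal_le (measure_ne_top _ _) hc).2 (h ϑ))
            exact fun ω hω => hω.1
          · have : (fun f => (f, ϑ)) ⁻¹' (S ∩ Prod.snd ⁻¹' A) = ∅ := by
              ext f
              simp [hϑ]
            simp [this]
      _ = ENNReal.ofReal c * μ (θ ⁻¹' A) := by
          rw [lintegral_indicator_const hA, Measure.map_apply hθ hA]
  have := ENNReal.toReal_mono (by finiteness) key
  rwa [ENNReal.toReal_mul, ENNReal.toReal_ofReal hc] at this

end Conditioning

/-! ### Modification to everywhere continuous paths -/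

section Modification

variable {Ω : Type*} {mΩ : MeasurableSpace Ω} {μ : Measure Ω}

/-- Paths in a null set containing all discontinuous ones are replaced by zero, which changes no law
and no independence. -/
lemma hasBrownianIncrements_indicator {W : ℝ → Ω → ℝ} (hm : ∀ t, Measurable (W t))
    (hind : HasIndepIncrements W μ)
    (hlaw : ∀ s t, s ≤ t → HasLaw (fun ω => W t ω - W s ω) (gaussianReal 0 (t - s).toNNReal) μ)
    {N : Set Ω} (hN : MeasurableSet N) (hN0 : μ N = 0)
    (hc : ∀ ω ∉ N, Continuous fun t => W t ω) :
    HasBrownianIncrements (fun t => Nᶜ.indicator (W t)) μ where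
  measurable t := (hm t).indicator hN.compl
  continuous ω := by
    by_cases hω : ω ∈ N
    · simpa [hω] using continuous_const
    · simpa [hω] using hc ω hω
  indep n t ht := by
    refine (hind n t ht).congr fun i => ?_
    filter_upwards [measure_eq_zero_iff_ae_notMem.1 hN0] with ω hω
    simp [hω]
  law s t hst := by
    refine (hlaw s t hst).congr ?_
    filter_upwards [measure_eq_zero_iff_ae_notMem.1 hN0] with ω hω
    simp [hω]

lemma hasLaw_gaussianReal_of_hasGaussianLaw {X : Ω → ℝ} {v : ℝ} (hX : HasGaussianLaw X μ)
    (h0 : μ[X] = 0) (hv : Var[X; μ] = v) : HasLaw X (gaussianReal 0 v.toNNReal) μ where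
  aemeasurable := hX.aemeasurable
  map_eq := by rw [hX.map_eq_gaussianReal, h0, hv]

lemma IsCorrelatedBM.hasIndepIncrements_left {ρ : ℝ} {L R : ℝ → Ω → ℝ}
    (h : IsCorrelatedBM ρ L R μ) : HasIndepIncrements L μ :=
  h.indep_increments.map (ContinuousLinearMap.fst ℝ ℝ ℝ)

lemma IsCorrelatedBM.hasIndepIncrements_right {ρ : ℝ} {L R : ℝ → Ω → ℝ}
    (h : IsCorrelatedBM ρ L R μ) : HasIndepIncrements R μ :=
  h.indep_increments.map (ContinuousLinearMap.snd ℝ ℝ ℝ)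

lemma IsCorrelatedBM.exists_null_set {ρ : ℝ} {L R : ℝ → Ω → ℝ} (h : IsCorrelatedBM ρ L R μ) :
    ∃ N, μ N = 0 ∧
      HasBrownianIncrements (fun t => Nᶜ.indicator (L t)) μ ∧
      HasBrownianIncrements (fun t => Nᶜ.indicator (R t)) μ := by
  obtain ⟨N, hsub, hN, hN0⟩ := exists_measurable_superset_of_null (ae_iff.1 h.continuous_paths)
  have hc : ∀ ω ∉ N, Continuous (fun t => L t ω) ∧ Continuous fun t => R t ω :=
    fun ω hω => by_contra fun hcon => hω (hsub hcon)
  refine ⟨N, hN0, ?_, ?_⟩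
  · exact hasBrownianIncrements_indicator h.measurable_left h.hasIndepIncrements_left
      (fun s t hst => hasLaw_gaussianReal_of_hasGaussianLaw (h.gaussian_increments s t hst).fst
        (h.mean_left s t hst) (h.variance_left s t hst)) hN hN0 fun ω hω => (hc ω hω).1
  · exact hasBrownianIncrements_indicator h.measurable_right h.hasIndepIncrements_right
      (fun s t hst => hasLaw_gaussianReal_of_hasGaussianLaw (h.gaussian_increments s t hst).snd
        (h.mean_right s t hst) (h.variance_right s t hst)) hN hN0 fun ω hω => (hc ω hω).2

end Modification

/-! ### Random paths and the conditional degree bound -/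

/-- The space of continuous planar paths, with the σ-algebra generated by the evaluations. -/
abbrev PlanarPath : Type := {f : ℝ → ℝ × ℝ // Continuous f}

lemma measurable_planarPath_eval (t : ℝ) : Measurable fun f : PlanarPath => f.1 t :=
  (measurable_pi_apply t).comp measurable_subtype_coe

/-- The pairs of a path and a shift for which the vertex number `K ϑ` has more than `n` edges. -/
def largeDegreeSet (ε : ℝ) (K : ℝ → ℤ) (n : ℕ) : Set (PlanarPath × ℝ) :=
  {p | (n : ℕ∞) < {i : Bool × ℕ × Bool | HasEdge (fun t => (p.1.1 t).1) (fun t => (p.1.1 t).2) ε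
    (cellPair ε (ε * K p.2 + ε * p.2) i.1 i.2.1).1
    (cellPair ε (ε * K p.2 + ε * p.2) i.1 i.2.1).2 i.2.2}.encard}

lemma measurableSet_largeDegreeSet {ε : ℝ} (hε : 0 < ε) {K : ℝ → ℤ} (hK : Measurable K) (n : ℕ) :
    MeasurableSet (largeDegreeSet ε K n) := by
  refine measurableSet_lt_encard (fun i => ?_) n
  obtain ⟨s, k, b⟩ := i
  have hx : Measurable fun p : PlanarPath × ℝ => ε * K p.2 + ε * p.2 :=
    (((measurable_of_countable (fun j : ℤ => (j : ℝ))).comp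
      (hK.comp measurable_snd)).const_mul ε).add (measurable_snd.const_mul ε)
  refine measurableSet_hasEdge
    (u := fun t (p : PlanarPath × ℝ) => (p.1.1 t).1) (v := fun t (p : PlanarPath × ℝ) => (p.1.1 t).2)
    (fun p => continuous_fst.comp p.1.2)
    (fun t => measurable_fst.comp ((measurable_planarPath_eval t).comp measurable_fst))
    (fun p => continuous_snd.comp p.1.2)
    (fun t => measurable_snd.comp ((measurable_planarPath_eval t).comp measurable_fst))
    hε.le ?_ ?_ ?_ b
  · cases s
    · simpa [cellPair] using hx.sub_const _
    · simpa [cellPair] using hx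
  · cases s
    · simpa [cellPair] using hx
    · simpa [cellPair] using hx.add_const _
  · intro p
    have : 0 ≤ ε * k := by positivity
    cases s <;> simp [cellPair] <;> linarith

end MatedCRT

open MatedCRT

theorem lemma2p1 (γ : ℝ) (hγ₀ : 0 < γ) (hγ₂ : γ < 2) :
    ∃ c₀ c₁ : ℝ, 0 < c₀ ∧ 0 < c₁ ∧
      ∀ {Ω : Type*} [MeasurableSpace Ω] (μ : Measure Ω) [IsProbabilityMeasure μ]
        (L R : ℝ → Ω → ℝ) (θ : Ω → ℝ),
        MatedCRT.IsCorrelatedBM (MatedCRT.correlation γ) L R μ →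
        Measurable θ →
        pdf.IsUniform θ (Set.Icc 0 1) μ →
        IndepFun (fun ω (t : ℝ) => (L t ω, R t ω)) θ μ →
        ∀ (n : ℕ) (ε : ℝ), 0 < n → 0 < ε →
        -- the vertex `x ω ∈ εℤ + ε θ ω` is chosen as a measurable function of `θ`
        ∀ x : Ω → ℝ, Measurable[MeasurableSpace.comap θ inferInstance] x →
          (∀ ω, x ω ∈ MatedCRT.vertices ε (θ ω)) →
          let E : Set Ω := {ω | (n : ℕ∞) < MatedCRT.deg (x ω)
            (MatedCRT.matedCRTMap (fun t => L t ω) (fun t => R t ω) ε (θ ω))}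
          NullMeasurableSet E μ ∧
            ∀ᵐ ω ∂μ, (μ⟦E | MeasurableSpace.comap θ inferInstance⟧) ω
              ≤ c₀ * Real.exp (-c₁ * n) := by
  refine ⟨4 * tailConst * Real.exp tailRate, tailRate / 8, ?_, ?_, ?_⟩
  · have := tailConst_pos
    positivity
  · have := tailRate_pos
    positivity
  intro Ω _ μ _ L R θ hBM hθ _ hind n ε _ hε x hx hxv E
  obtain ⟨N, hN0, hL, hR⟩ := hBM.exists_null_set
  obtain ⟨g, hg, rfl⟩ := hx.exists_eq_measurable_comp
  -- The floor gives an integer index for every `ϑ`, also off the range of `θ`, so the bound holds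
  -- for each fixed `ϑ`. On the range it is the true index of the vertex.
  let K : ℝ → ℤ := fun ϑ => ⌊g ϑ / ε - ϑ⌋
  have hK : Measurable K := ((hg.div_const ε).sub measurable_id).floor
  have hgK (ω : Ω) : g (θ ω) = ε * K (θ ω) + ε * θ ω := by
    obtain ⟨j, hj⟩ := hxv ω
    have hj' : g (θ ω) = ε * j + ε * θ ω := hj
    have : K (θ ω) = j := by
      have : g (θ ω) / ε - θ ω = j := by
        rw [hj']
        field_simp
        ring
      simp [K, this]
    rw [this, hj']
  let Φ : Ω → PlanarPath := fun ω => ⟨fun t => (Nᶜ.indicator (L t) ω, Nᶜ.indicator (R t) ω),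
    (hL.continuous ω).prodMk (hR.continuous ω)⟩
  have hΦ : Measurable Φ :=
    (measurable_pi_lambda _ fun t => (hL.measurable t).prodMk (hR.measurable t)).subtype_mk
  have hNae : ∀ᵐ ω ∂μ, ω ∉ N := measure_eq_zero_iff_ae_notMem.1 hN0
  have hindΦ : IndepFun Φ θ μ := by
    have h1 : IndepFun (fun ω => (Φ ω).1) θ μ := by
      refine hind.congr ?_ .rfl
      filter_upwards [hNae] with ω hω
      ext t <;> simp [Φ, hω]
    rw [IndepFun_iff_Indep] at h1 ⊢
    -- The σ-algebra on `PlanarPath` is induced from the product space, so independence passes to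
    -- `Φ`.
    have h2 : MeasurableSpace.comap Φ inferInstance =
        MeasurableSpace.comap (fun ω => (Φ ω).1) inferInstance :=
      MeasurableSpace.comap_comp
    rwa [h2]
  set S := largeDegreeSet ε K n
  have hSm : MeasurableSet S := measurableSet_largeDegreeSet hε hK n
  have hE : E =ᵐ[μ] {ω | (Φ ω, θ ω) ∈ S} := by
    filter_upwards [hNae] with ω hω
    refine propext ?_
    change (n : ℕ∞) < _ ↔ (n : ℕ∞) < _
    rw [deg_eq_encard hε (hxv ω)]
    simp [Φ, hω, hgK]
  have hE' : MeasurableSet {ω | (Φ ω, θ ω) ∈ S} := (hΦ.prodMk hθ) hSm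
  refine ⟨hE'.nullMeasurableSet.congr hE.symm, ?_⟩
  refine condExp_indicator_le_of_forall hθ.comap_le (hE'.nullMeasurableSet.congr hE.symm) ?_
  rintro _ ⟨A, hA, rfl⟩
  rw [measureReal_congr (hE.inter (ae_eq_refl (θ ⁻¹' A)))]
  refine hindΦ.measureReal_inter_preimage_le hΦ hθ hSm (by have := tailConst_pos; positivity) ?_ hA
  intro ϑ
  exact measure_lt_degree_le hL hR hε (ε * K ϑ + ε * ϑ) n
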